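/- Theorem 3.2. Let $A,D\in\mathbb C^{n\times n}$, $\lambda_0\in\mathbb C$, and let $k\ge1$ and $s_1,\dots,s_{k-1}\ge 0$, $s_k>0$ be integers. Let $[\Xi\ \ \Xi_c]\in\mathbb C^{n\times n}$ be invertible with $$A[\Xi\ \ \Xi_c]=[\Xi\ \ \Xi_c]\begin{bmatrix}\lambda_0I+N&0\\0&A_{22}\end{bmatrix},\qquad N=\operatorname{diag}(N_1,\dots,N_k),\qquad \lambda_0\notin\Lambda(A_{22}),$$ where $N_j$ is the $j\times j$ block matrix with blocks of size $s_j\times s_j$, identity blocks $I_{s_j}$ on the first block superdiagonal and zero blocks elsewhere. Put $[\Sigma\ \ \Sigma_c]=[\Xi\ \ \Xi_c]^{-*}$ and partition $\Xi=[\Xi_1\ \dots\ \Xi_k]$, $\Xi_j=[\Xi_{j1}\ \dots\ \Xi_{jj}]$, $\Sigma=[\Sigma_1\ \dots\ \Sigma_k]$, $\Sigma_j=[\Sigma_{j1}\ \dots\ \Sigma_{jj}]$, where $\Xi_{jm}$ and $\Sigma_{jm}$ have $s_j$ columns. For $1\le j\le k$ let $$\tilde\Xi_j=[\Xi_{j1}\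 \Xi_{j+1,1}\ \dots\ \Xi_{k1}],\qquad \tilde\Sigma_j=[\Sigma_{jj}\ \Sigma_{j+1,j+1}\ \dots\ \Sigma_{kk}],\qquad W_j=\tilde\Sigma_j^*D\tilde\Xi_j .$$ Fix $\rho\in\{1,\dots,k\}$ and assume that $W_\rho$ and, if $\rho<k$, also $W_{\rho+1}$ are invertible (in particular, this holds under the generic condition that all of $W_1,\dots,W_k$ are invertible). Let $$G_\rho^{(\rho)}=-W_{\rho+1}^{-1}\tilde\Sigma_{\rho+1}^*D\,\Xi_{\rho1},\qquad S_\rho=\Sigma_{\rho\rho}^*D\,\Xi_{\rho1}+\Sigma_{\rho\rho}^*D\,\tilde\Xi_{\rho+1}G_\rho^{(\rho)}$$ (for $\rho=k$ the matrix $G_\rho^{(\rho)}$ is void and $S_k=W_k$), and let $\Theta_\rho$ be the $\rho\times\rho$ block matrix with blocks of size $s_\rho\times s_\rho$, identity blocks $I_{s_\rho}$ on the first block superdiagonal, $S_\rho$ in the bottom left corner and zero blocks elsewhere ($\Theta_1=S_1$). Let $\Omega\in\mathbb C^{r\times r}$ and $\tilde\Phi\in\mathbb C^{\rho s_\rho\times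 r}$ satisfy $\operatorname{rank}\tilde\Phi=r$ and $\Theta_\rho\tilde\Phi=\tilde\Phi\Omega$, suppose that the eigenvalues of $\Omega$ are different from the remaining eigenvalues of $\Theta_\rho$ (counted with algebraic multiplicity), and let $Q_1\in\mathbb C^{s_\rho\times r}$ be the top block of $\tilde\Phi$. Then for all sufficiently small $t>0$ there are $C=C(t)\in\mathbb C^{r\times r}$ and $H=H(t)\in\mathbb C^{n\times r}$ of full column rank $r$ with $(A+tD)H=HC$ such that, as $t\to0^+$, $$C=\lambda_0I+t^{1/\rho}\Omega+O(t^{2/\rho}),\qquad H=\tilde\Xi_\rho\begin{bmatrix}I_{s_\rho}\\G_\rho^{(\rho)}\end{bmatrix}Q_1+\sum_{i=1}^k\Xi_iH_i+O(t),$$ where $H_i=H_i(t)$ has $i$ block rows, each with $s_i$ rows, and $$H_\rho=\begin{bmatrix}0\\Q_1(t^{1/\rho}\Omega)\\\vdots\\Q_1(t^{1/\rho}\Omega)^{\rho-1}\end{bmatrix}+O\left(\begin{bmatrix}t^{1/\rho}\\t^{2/\rho}\\\vdots\\t\end{bmatrix}\right),$$ $$H_i=O\left(\begin{bmatrix}t^{1-i/\rho}&t^{1-(i-1)/\rho}&\cdots&t^{1-1/\rho}\end{bmatrix}^T\right)\quad(1\le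 i\le\rho-1),$$ and, for $\rho+1\le i\le k$, the first block row of $H_i$ is $O(t^{1/\rho})$ and its $m$-th block row is $O(t^{\min(m-1,\rho)/\rho})$ for $2\le m\le i$, that is, $$H_i=O\left(\begin{bmatrix}t^{1/\rho}&t^{1/\rho}&t^{2/\rho}&\cdots&t^{1-1/\rho}&t&\cdots&t\end{bmatrix}^T\right).$$ -/

import Mathlib

open Filter Topology

namespace JordanPert

/-- The admissible Jordan block sizes `1, …, k`. -/
abbrev BlockSize (k : ℕ) : Type := {i : ℕ // i ∈ Finset.Icc 1 k}

/-- Column index of `Ξ = [Ξ₁ … Ξ_k]`, `Ξ_i = [Ξ_{i1} … Ξ_{ii}]`, where `Ξ_{im}` has `s i` columns.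
The index `⟨i, (m, p)⟩` is column `p` of `Ξ_{i,m+1}` (positions are counted from `0`). -/
abbrev JordanIdx (k : ℕ) (s : ℕ → ℕ) : Type := Σ i : BlockSize k, Fin i.1 × Fin (s i.1)

/-- Index set with one copy of `Fin (s i)` for each block size `i` with `j ≤ i ≤ k`;
it is empty for `j = k + 1`. -/
abbrev TailIdx (k : ℕ) (s : ℕ → ℕ) (j : ℕ) : Type :=
  Σ i : {i : BlockSize k // j ≤ i.1}, Fin (s i.1.1)

theorem BlockSize.pos {k : ℕ} (i : BlockSize k) : 0 < i.1 := (Finset.mem_Icc.mp i.2).1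

/-- First position in a chain of length `i`. -/
def firstPos {k : ℕ} (i : BlockSize k) : Fin i.1 := ⟨0, i.pos⟩

/-- Last position in a chain of length `i`. -/
def lastPos {k : ℕ} (i : BlockSize k) : Fin i.1 := ⟨i.1 - 1, Nat.sub_lt i.pos Nat.one_pos⟩

/-- `N = diag(N₁, …, N_k)`, where `N_i` is the `i × i` block matrix with identity blocks `I_{s_i}`
on the first block superdiagonal. -/
def nilp (k : ℕ) (s : ℕ → ℕ) : Matrix (JordanIdx k s) (JordanIdx k s) ℂ :=
  Matrix.blockDiagonal' fun i : BlockSize k =>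
    (Matrix.of fun p q => if (p.1 : ℕ) + 1 = (q.1 : ℕ) ∧ p.2 = q.2 then 1 else 0 :
      Matrix (Fin i.1 × Fin (s i.1)) (Fin i.1 × Fin (s i.1)) ℂ)

variable {n k : ℕ} {s : ℕ → ℕ}

/-- The block column `Ξ_i` of `Ξ`. -/
def blockCol (X : Matrix (Fin n) (JordanIdx k s) ℂ) (i : BlockSize k) :
    Matrix (Fin n) (Fin i.1 × Fin (s i.1)) ℂ :=
  Matrix.of fun a q => X a ⟨i, q⟩

/-- The sub-block column `Ξ_{i,m+1}` of `Ξ`. -/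
def subCol (X : Matrix (Fin n) (JordanIdx k s) ℂ) (i : BlockSize k) (m : Fin i.1) :
    Matrix (Fin n) (Fin (s i.1)) ℂ :=
  Matrix.of fun a p => X a ⟨i, (m, p)⟩

/-- `[Ξ_{j1} Ξ_{j+1,1} … Ξ_{k1}]`. -/
def firstCols (X : Matrix (Fin n) (JordanIdx k s) ℂ) (j : ℕ) :
    Matrix (Fin n) (TailIdx k s j) ℂ :=
  Matrix.of fun a q => subCol X q.1.1 (firstPos q.1.1) a q.2

/-- `[Σ_{jj} Σ_{j+1,j+1} … Σ_{kk}]`. -/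
def lastCols (Y : Matrix (Fin n) (JordanIdx k s) ℂ) (j : ℕ) :
    Matrix (Fin n) (TailIdx k s j) ℂ :=
  Matrix.of fun a q => subCol Y q.1.1 (lastPos q.1.1) a q.2

/-- `W_j`, the product of the adjoint of `[Σ_{jj} … Σ_{kk}]`, `D` and `[Ξ_{j1} … Ξ_{k1}]`.
For `j = k + 1` it is the `0 × 0` matrix. -/
def matW (D : Matrix (Fin n) (Fin n) ℂ) (X Y : Matrix (Fin n) (JordanIdx k s) ℂ) (j : ℕ) :
    Matrix (TailIdx k s j) (TailIdx k s j) ℂ :=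
  (lastCols Y j).conjTranspose * D * firstCols X j

/-- `G_ρ = - W_{ρ+1}⁻¹ Z`, where `Z` stacks the blocks `Σ_{ii}* D Ξ_{ρ1}`, `ρ < i ≤ k`. -/
noncomputable def matG (D : Matrix (Fin n) (Fin n) ℂ) (X Y : Matrix (Fin n) (JordanIdx k s) ℂ)
    (ρ : BlockSize k) : Matrix (TailIdx k s (ρ.1 + 1)) (Fin (s ρ.1)) ℂ :=
  -((matW D X Y (ρ.1 + 1))⁻¹ *
    ((lastCols Y (ρ.1 + 1)).conjTranspose * D * subCol X ρ (firstPos ρ)))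

/-- The block matrix with `I_{s_ρ}` on top of `G`, its rows indexed by the sizes `ρ, …, k`. -/
def stackI (ρ : BlockSize k) (G : Matrix (TailIdx k s (ρ.1 + 1)) (Fin (s ρ.1)) ℂ) :
    Matrix (TailIdx k s ρ.1) (Fin (s ρ.1)) ℂ :=
  Matrix.of fun p q =>
    if h : ρ.1 + 1 ≤ p.1.1.1 then G ⟨⟨p.1.1, h⟩, p.2⟩ q
    else if (p.2 : ℕ) = (q : ℕ) then 1 else 0

/-- `S_ρ = Σ_{ρρ}* D Ξ_{ρ1} + (Σ_{ρρ}* D [Ξ_{ρ+1,1} … Ξ_{k1}]) G_ρ`. -/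
noncomputable def matS (D : Matrix (Fin n) (Fin n) ℂ) (X Y : Matrix (Fin n) (JordanIdx k s) ℂ)
    (ρ : BlockSize k) : Matrix (Fin (s ρ.1)) (Fin (s ρ.1)) ℂ :=
  (subCol Y ρ (lastPos ρ)).conjTranspose * D * subCol X ρ (firstPos ρ) +
    (subCol Y ρ (lastPos ρ)).conjTranspose * D * firstCols X (ρ.1 + 1) * matG D X Y ρ

/-- `Θ_ρ`: the `ρ × ρ` block matrix with `I_{s_ρ}` on the first block superdiagonal, `S_ρ` in the
bottom left corner and zeros elsewhere. For `ρ = 1` it is `S_1`. -/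
noncomputable def matTheta (D : Matrix (Fin n) (Fin n) ℂ)
    (X Y : Matrix (Fin n) (JordanIdx k s) ℂ) (ρ : BlockSize k) :
    Matrix (Fin ρ.1 × Fin (s ρ.1)) (Fin ρ.1 × Fin (s ρ.1)) ℂ :=
  Matrix.of fun p q =>
    if (p.1 : ℕ) + 1 = (q.1 : ℕ) then (if p.2 = q.2 then 1 else 0)
    else if p.1 = lastPos ρ ∧ q.1 = firstPos ρ then matS D X Y ρ p.2 q.2 else 0

/-- The top block `Q₁` of a matrix with `ρ` block rows. -/
def topBlock {r : ℕ} (ρ : BlockSize k) (Φ : Matrix (Fin ρ.1 × Fin (s ρ.1)) (Fin r) ℂ) :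
    Matrix (Fin (s ρ.1)) (Fin r) ℂ :=
  Matrix.of fun p q => Φ (firstPos ρ, p) q

/-- `M(t) = O(t^c)` entrywise, as `t → 0⁺`. -/
def MatBigO {α β : Type*} (M : ℝ → Matrix α β ℂ) (c : ℝ) : Prop :=
  ∀ a b, (fun t => M t a b) =O[𝓝[>] (0 : ℝ)] fun t : ℝ => t ^ c

/-- Block row `m + 1` of a matrix with `i` block rows. -/
def blockRow {r : ℕ} {i : BlockSize k} (M : Matrix (Fin i.1 × Fin (s i.1)) (Fin r) ℂ)
    (m : Fin i.1) : Matrix (Fin (s i.1)) (Fin r) ℂ :=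
  Matrix.of fun p q => M (m, p) q

end JordanPert

open JordanPert

/-!
Put `z = t ^ (1 / ρ)`. In the basis `[Ξ Ξ_c]` the matrix `A + t D - λ₀` becomes `K + z ^ ρ B` with
`K = diag(N, A₂₂ - λ₀)` and `B = [Σ Σ_c]* D [Ξ Ξ_c]`. Scaling row `a` of the unknown by `z ^ w a`,
where the weights `w` grow by one along each Jordan chain (capped at `ρ`), so that
`K z ^ w = z ^ v K` with `v = min (w + 1) ρ`, turns the equation `(K + z ^ ρ B) H = H (z C)` into
one that is polynomial in `z`. At `z = 0` the rows of the chains longer than `ρ` form a linear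
system with matrix `W_{ρ+1}`, whose elimination (a Schur complement) leaves `Θ_ρ Φ = Φ Ω` on the
chains of length `ρ`; all other rows are determined by these because `A₂₂ - λ₀` and `Ω` are
invertible. Since the spectrum of `Ω` is separated from the rest of the spectrum of `Θ_ρ`, the
invariant pair `(Φ, Ω)` is a simple zero of the equation normalized by `P y = 1`, and the implicit
function theorem continues it to small `z`.
-/

namespace JordanPert

section Sylvester

variable {α β : Type*} [Fintype α] [DecidableEq α] [Fintype β] [DecidableEq β]

open Polynomial in
theorem aeval_mul_eq_mul_aeval {R : Type*} [CommRing R] {M : Matrix α α R} {N : Matrix β β R}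
    {X : Matrix α β R} (h : M * X = X * N) (p : R[X]) : aeval M p * X = X * aeval N p := by
  have pow_mul_eq (j : ℕ) : M ^ j * X = X * N ^ j := by
    induction j with
    | zero => simp
    | succ j ih =>
      rw [pow_succ, Matrix.mul_assoc, h, ← Matrix.mul_assoc, ih, Matrix.mul_assoc, pow_succ]
  induction p using Polynomial.induction_on' with
  | add p q hp hq => simp only [map_add, Matrix.add_mul, Matrix.mul_add, hp, hq]
  | monomial j a =>
    simp only [aeval_monomial, Algebra.algebraMap_eq_smul_one, Matrix.smul_mul, Matrix.mul_smul,
      pow_mul_eq, smul_mul_assoc, one_mul]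

theorem eq_zero_of_mul_eq_mul_of_isCoprime_charpoly {R : Type*} [CommRing R] {M : Matrix α α R}
    {N : Matrix β β R} {X : Matrix α β R} (hMN : IsCoprime N.charpoly M.charpoly)
    (h : M * X = X * N) : X = 0 := by
  obtain ⟨a, b, hab⟩ := hMN
  calc X = Polynomial.aeval M (a * N.charpoly + b * M.charpoly) * X := by
        rw [hab, map_one, Matrix.one_mul]
    _ = X * Polynomial.aeval N (a * N.charpoly) := by
        rw [map_add, map_mul (Polynomial.aeval M) b, Matrix.aeval_self_charpoly, mul_zero, add_zero,
          aeval_mul_eq_mul_aeval h]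
    _ = 0 := by rw [map_mul, Matrix.aeval_self_charpoly, mul_zero, Matrix.mul_zero]

end Sylvester

section SimpleInvariantPair

variable {𝕜 ι β : Type*} [Field 𝕜] [Fintype ι] [DecidableEq ι] [Fintype β] [DecidableEq β]

/-- `(y, Ω)` is a simple invariant pair of the pencil `M - μ E`, normalized by `P`: it solves
`M y = E y Ω`, `P y = 1`, and the linearization of these equations at `(y, Ω)` is injective. -/
structure IsSimpleInvariantPair (M E : Matrix ι ι 𝕜) (P : Matrix β ι 𝕜) (y : Matrix ι β 𝕜)
    (Ω : Matrix β β 𝕜) : Prop where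
  normalized : P * y = 1
  mul_eq : M * y = E * (y * Ω)
  eq_zero : ∀ (V : Matrix ι β 𝕜) (C : Matrix β β 𝕜),
    M * V = E * (V * Ω + y * C) → P * V = 0 → V = 0 ∧ C = 0

theorem exists_invertible_fromCols {Φ : Matrix ι β 𝕜} (hΦ : Φ.rank = Fintype.card β) :
    ∃ (d : ℕ) (Φc : Matrix ι (Fin d) 𝕜) (P : Matrix β ι 𝕜) (Pc : Matrix (Fin d) ι 𝕜),
      Matrix.fromRows P Pc * Matrix.fromCols Φ Φc = 1 ∧
      Matrix.fromCols Φ Φc * Matrix.fromRows P Pc = 1 := by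
  have linInd : LinearIndependent 𝕜 Φ.col := by
    rw [linearIndependent_iff_card_eq_finrank_span, Set.finrank, ← Matrix.rank_eq_finrank_span_cols,
      hΦ]
  let extended := Module.Basis.sumExtend linInd
  have : Fintype (β ⊕ Module.Basis.sumExtendIndex linInd) :=
    FiniteDimensional.fintypeBasisIndex extended
  have : Fintype (Module.Basis.sumExtendIndex linInd) := Fintype.ofInjective
    (Sum.inr : _ → β ⊕ Module.Basis.sumExtendIndex linInd) Sum.inr_injective
  let b := extended.reindex (Equiv.sumCongr (Equiv.refl β) (Fintype.equivFin _))
  let U := (Pi.basisFun 𝕜 ι).toMatrix b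
  let U' := b.toMatrix (Pi.basisFun 𝕜 ι)
  have fromCols_eq : Matrix.fromCols Φ U.toCols₂ = U := by
    ext a (q | q)
    · have b_inl : b (Sum.inl q) = Φ.col q := by
        simp only [b, extended, Module.Basis.sumExtend, Equiv.trans_def, Module.Basis.coe_reindex,
          Module.Basis.coe_extend, Equiv.sumCongr_symm, Equiv.refl_symm, Function.comp_apply,
          Equiv.sumCongr_apply, Equiv.coe_refl, Sum.map_inl, id_eq]
        rfl
      exact (congrFun b_inl a).symm
    · rfl
  refine ⟨_, U.toCols₂, U'.toRows₁, U'.toRows₂, ?_⟩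
  rw [fromCols_eq, Matrix.fromRows_toRows]
  exact ⟨Module.Basis.toMatrix_mul_toMatrix_flip _ _, Module.Basis.toMatrix_mul_toMatrix_flip _ _⟩

theorem charpoly_eq_of_mul_eq_one {U : Matrix ι β 𝕜} {U' : Matrix β ι 𝕜} (h : U * U' = 1)
    (h' : U' * U = 1) (M : Matrix ι ι 𝕜) : (U' * M * U).charpoly = M.charpoly := by
  have card_eq : Fintype.card ι = Fintype.card β := Matrix.square_of_invertible U U' h h'
  have := Matrix.charpoly_mul_comm' (U' * M) U
  rw [card_eq, ← Matrix.mul_assoc, h, Matrix.one_mul] at this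
  exact mul_left_cancel₀ (pow_ne_zero _ Polynomial.X_ne_zero) this

open Polynomial in
theorem isCoprime_of_forall_notMem_roots_sub [IsAlgClosed 𝕜] [DecidableEq 𝕜] {p q : 𝕜[X]}
    (hp : p ≠ 0) (hq : q ≠ 0) (h : ∀ μ ∈ p.roots, μ ∉ (p * q).roots - p.roots) : IsCoprime p q := by
  rw [roots_mul (mul_ne_zero hp hq), add_tsub_cancel_left] at h
  rw [isCoprime_iff_aeval_ne_zero_of_isAlgClosed 𝕜 𝕜]
  intro a
  simpa [mem_roots hp, mem_roots hq, imp_iff_not_or] using h a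

theorem exists_isSimpleInvariantPair [IsAlgClosed 𝕜] [DecidableEq 𝕜] {M : Matrix ι ι 𝕜}
    {Ω : Matrix β β 𝕜} {Φ : Matrix ι β 𝕜} (hrank : Φ.rank = Fintype.card β) (hΦ : M * Φ = Φ * Ω)
    (hsep : ∀ μ ∈ Ω.charpoly.roots, μ ∉ M.charpoly.roots - Ω.charpoly.roots) :
    ∃ P : Matrix β ι 𝕜, IsSimpleInvariantPair M 1 P Φ Ω := by
  obtain ⟨d, Φc, P, Pc, hPΦ, hΦP⟩ := exists_invertible_fromCols hrank
  have charpoly_eq := charpoly_eq_of_mul_eq_one hΦP hPΦ M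
  rw [Matrix.fromRows_mul_fromCols, ← Matrix.fromBlocks_one, Matrix.fromBlocks_inj] at hPΦ
  obtain ⟨hPΦ, -, hPcΦ, -⟩ := hPΦ
  rw [Matrix.fromCols_mul_fromRows] at hΦP
  rw [Matrix.fromRows_mul, Matrix.fromRows_mul_fromCols, Matrix.mul_assoc P, Matrix.mul_assoc Pc,
    hΦ, ← Matrix.mul_assoc, ← Matrix.mul_assoc, hPΦ, hPcΦ, Matrix.one_mul, Matrix.zero_mul,
    Matrix.charpoly_fromBlocks_zero₂₁] at charpoly_eq
  have coprime : IsCoprime Ω.charpoly (Pc * M * Φc).charpoly :=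
    isCoprime_of_forall_notMem_roots_sub (Matrix.charpoly_monic _).ne_zero
      (Matrix.charpoly_monic _).ne_zero (by rwa [charpoly_eq])
  refine ⟨P, hPΦ, by rw [hΦ, Matrix.one_mul], fun V C hVC hPV => ?_⟩
  rw [Matrix.one_mul] at hVC
  have eq_Φc_mul : V = Φc * (Pc * V) := by
    have := congrArg (· * V) hΦP
    simp only [Matrix.add_mul, Matrix.mul_assoc, hPV, Matrix.mul_zero, zero_add,
      Matrix.one_mul] at this
    exact this.symm
  have sylvester : Pc * M * Φc * (Pc * V) = Pc * V * Ω := by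
    rw [Matrix.mul_assoc, ← eq_Φc_mul, Matrix.mul_assoc, hVC, Matrix.mul_add, ← Matrix.mul_assoc,
      ← Matrix.mul_assoc Pc Φ, hPcΦ, Matrix.zero_mul, add_zero]
  have hV : V = 0 := by
    rw [eq_Φc_mul, eq_zero_of_mul_eq_mul_of_isCoprime_charpoly coprime sylvester, Matrix.mul_zero]
  subst hV
  rw [Matrix.mul_zero, Matrix.zero_mul, zero_add] at hVC
  refine ⟨rfl, ?_⟩
  rw [← Matrix.one_mul C, ← hPΦ, Matrix.mul_assoc, ← hVC, Matrix.mul_zero]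

end SimpleInvariantPair

section Reduction

variable {𝕜 α ι β : Type*} [Field 𝕜]

theorem exists_comp_eq_of_forall_eq_zero [Finite ι] {N : Type*} [AddCommGroup N] [Module 𝕜 N]
    [FiniteDimensional 𝕜 N] {f : α → ι} (hf : Function.Injective f) (L : (ι → N) →ₗ[𝕜] (ι → N))
    (hL : ∀ v, v ∘ f = 0 → (∀ a ∉ Set.range f, L v a = 0) → v = 0) (u : α → N) :
    ∃ v, v ∘ f = u ∧ ∀ a ∉ Set.range f, L v a = 0 := by
  classical
  let L' : (ι → N) →ₗ[𝕜] (ι → N) :=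
    LinearMap.pi fun a => if a ∈ Set.range f then LinearMap.proj a else LinearMap.proj a ∘ₗ L
  have L'_range (v x) : L' v (f x) = v (f x) := by simp [L']
  have L'_compl (v) {a} (ha : a ∉ Set.range f) : L' v a = L v a := by
    simp only [L', LinearMap.pi_apply, if_neg ha, LinearMap.comp_apply, LinearMap.proj_apply]
  have injective : Function.Injective L' := by
    refine (injective_iff_map_eq_zero L').2 fun v hv => hL v ?_ fun a ha => ?_
    · exact funext fun x => by simpa [hv] using (L'_range v x).symm
    · simpa [hv] using (L'_compl v ha).symm
  obtain ⟨v, hv⟩ := LinearMap.surjective_of_injective injective (Function.extend f u 0)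
  refine ⟨v, funext fun x => ?_, fun a ha => ?_⟩
  · rw [Function.comp_apply, ← L'_range v x, hv, hf.extend_apply]
  · rw [← L'_compl v ha, hv, Function.extend_apply' _ _ _ ha, Pi.zero_apply]

variable [Fintype ι] [Fintype α] [DecidableEq α] [Fintype β] [DecidableEq β]

theorem IsSimpleInvariantPair.exists_of_submatrix {f : α → ι} (hf : Function.Injective f)
    {M E : Matrix ι ι 𝕜} {Θ : Matrix α α 𝕜} {P : Matrix β α 𝕜} {Φ : Matrix α β 𝕜} {Ω : Matrix β β 𝕜}
    (h : IsSimpleInvariantPair Θ 1 P Φ Ω)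
    (hΘ : ∀ V T : Matrix ι β 𝕜, (∀ a ∉ Set.range f, ∀ q, (M * V) a q = (E * T) a q) →
      (M * V - E * T).submatrix f id = Θ * V.submatrix f id - T.submatrix f id)
    (huniq : ∀ V : Matrix ι β 𝕜, V.submatrix f id = 0 →
      (∀ a ∉ Set.range f, ∀ q, (M * V) a q = (E * (V * Ω)) a q) → V = 0) :
    ∃ (P' : Matrix β ι 𝕜) (y : Matrix ι β 𝕜),
      IsSimpleInvariantPair M E P' y Ω ∧ y.submatrix f id = Φ := by
  classical
  let L : Matrix ι β 𝕜 →ₗ[𝕜] Matrix ι β 𝕜 :=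
    mulLeftLinearMap β 𝕜 M - mulLeftLinearMap β 𝕜 E ∘ₗ mulRightLinearMap ι 𝕜 Ω
  obtain ⟨y, hyΦ, hy⟩ : ∃ y : Matrix ι β 𝕜, y.submatrix f id = Φ ∧
      ∀ a ∉ Set.range f, L y a = 0 :=
    exists_comp_eq_of_forall_eq_zero hf L
      (fun V hV hMV => huniq V hV fun a ha q => sub_eq_zero.1 (congrFun (hMV a ha) q)) Φ
  have submatrix_mul (V : Matrix ι β 𝕜) (C : Matrix β β 𝕜) :
      (V * C).submatrix f id = V.submatrix f id * C := rfl
  have restrict_mul (V : Matrix ι β 𝕜) :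
      P * (1 : Matrix ι ι 𝕜).submatrix f id * V = P * V.submatrix f id := by
    rw [Matrix.mul_assoc, ← Matrix.submatrix_id_id V,
      ← Matrix.submatrix_mul _ _ _ _ _ Function.bijective_id,
      Matrix.one_mul, Matrix.submatrix_id_id]
  refine ⟨P * (1 : Matrix ι ι 𝕜).submatrix f id, y, ⟨?_, ?_, fun V C hVC hPV => ?_⟩, hyΦ⟩
  · rw [restrict_mul, hyΦ, h.normalized]
  · have hyf := hΘ y (y * Ω) fun a ha q => sub_eq_zero.1 (congrFun (hy a ha) q)
    rw [submatrix_mul, hyΦ, h.mul_eq, Matrix.one_mul, sub_self] at hyf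
    rw [← sub_eq_zero]
    ext a q
    by_cases ha : a ∈ Set.range f
    · obtain ⟨x, rfl⟩ := ha
      exact congrFun₂ hyf x q
    · exact congrFun (hy a ha) q
  · have reduced := hΘ V _ fun a _ q => congrFun₂ hVC a q
    rw [sub_eq_zero.2 hVC, eq_comm] at reduced
    have theta_mul : Θ * V.submatrix f id =
        (1 : Matrix α α 𝕜) * (V.submatrix f id * Ω + Φ * C) := by
      rw [Matrix.one_mul, ← hyΦ]
      exact sub_eq_zero.1 reduced
    obtain ⟨hVf, rfl⟩ := h.eq_zero _ C theta_mul (by rw [← restrict_mul, hPV])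
    rw [Matrix.mul_zero, add_zero] at hVC
    exact ⟨huniq V hVf fun a _ q => congrFun₂ hVC a q, rfl⟩

end Reduction

section Continuation

open Asymptotics

theorem exists_implicit_curve {𝕜 Z E : Type*} [NontriviallyNormedField 𝕜] [CompleteSpace 𝕜]
    [NormedAddCommGroup Z] [NormedSpace 𝕜 Z] [CompleteSpace Z] [NormedAddCommGroup E]
    [NormedSpace 𝕜 E] [FiniteDimensional 𝕜 E] {F : Z × E → E} {F' : Z × E →L[𝕜] E} {z₀ : Z} {x₀ : E}
    (hF : HasStrictFDerivAt F F' (z₀, x₀)) (h₀ : F (z₀, x₀) = 0)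
    (hinj : ∀ v, F' (0, v) = 0 → v = 0) :
    ∃ x : Z → E, (∀ᶠ z in 𝓝 z₀, F (z, x z) = 0) ∧
      (fun z => x z - x₀) =O[𝓝 z₀] fun z => z - z₀ := by
  have : CompleteSpace E := FiniteDimensional.complete 𝕜 E
  have hinv : (F' ∘L ContinuousLinearMap.inr 𝕜 Z E).IsInvertible := by
    have injective : Function.Injective (F' ∘L ContinuousLinearMap.inr 𝕜 Z E : E →ₗ[𝕜] E) := by
      rw [injective_iff_map_eq_zero]
      exact fun v hv => hinj v (by simpa using hv)
    exact ⟨(LinearEquiv.ofInjectiveEndo _ injective).toContinuousLinearEquiv, rfl⟩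
  have apply_z₀ : hF.implicitFunctionOfProdDomain hinv z₀ = x₀ :=
    (hF.eventually_apply_eq_iff_implicitFunctionOfProdDomain hinv).self_of_nhds.mp rfl
  refine ⟨hF.implicitFunctionOfProdDomain hinv, ?_, ?_⟩
  · simpa [h₀] using hF.eventually_apply_implicitFunctionOfProdDomain hinv
  · simpa [apply_z₀] using
      (hF.hasStrictFDerivAt_implicitFunctionOfProdDomain hinv).hasFDerivAt.isBigO_sub

variable {𝕜 ι β : Type*} [Fintype ι] [Fintype β] [DecidableEq β]

/-- The residual `(M y - E y C, P y - 1)` of the normalized invariant pair equations. -/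
def pairResidual [Ring 𝕜] (M E : Matrix ι ι 𝕜) (P : Matrix β ι 𝕜)
    (x : Matrix ι β 𝕜 × Matrix β β 𝕜) : Matrix ι β 𝕜 × Matrix β β 𝕜 :=
  (M * x.1 - E * (x.1 * x.2), P * x.1 - 1)

theorem pairResidual_eq_zero_iff [Ring 𝕜] {M E : Matrix ι ι 𝕜} {P : Matrix β ι 𝕜}
    {x : Matrix ι β 𝕜 × Matrix β β 𝕜} :
    pairResidual M E P x = 0 ↔ M * x.1 = E * (x.1 * x.2) ∧ P * x.1 = 1 := by
  rw [pairResidual, Prod.mk_eq_zero, sub_eq_zero, sub_eq_zero]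

theorem pairResidual_add_smul [CommRing 𝕜] (M E : Matrix ι ι 𝕜) (P : Matrix β ι 𝕜)
    (x v : Matrix ι β 𝕜 × Matrix β β 𝕜) (c : 𝕜) :
    pairResidual M E P (x + c • v) = pairResidual M E P x +
      c • (M * v.1 - E * (v.1 * x.2 + x.1 * v.2), P * v.1) - c ^ 2 • (E * (v.1 * v.2), 0) := by
  simp only [pairResidual, Prod.fst_add, Prod.snd_add, Prod.smul_fst, Prod.smul_snd, Matrix.mul_add,
    Matrix.add_mul, Matrix.mul_smul, Matrix.smul_mul]
  ext1 <;> simp only [Prod.fst_add, Prod.snd_add, Prod.fst_sub, Prod.snd_sub, Prod.smul_fst,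
    Prod.smul_snd] <;> module

open scoped Matrix.Norms.Elementwise

theorem hasDerivAt_pairResidual [RCLike 𝕜] (M E : Matrix ι ι 𝕜) (P : Matrix β ι 𝕜)
    (x v : Matrix ι β 𝕜 × Matrix β β 𝕜) :
    HasDerivAt (fun c : 𝕜 => pairResidual M E P (x + c • v))
      (M * v.1 - E * (v.1 * x.2 + x.1 * v.2), P * v.1) 0 := by
  simp only [pairResidual_add_smul]
  have linear := (hasDerivAt_id (0 : 𝕜)).smul_const
    (M * v.1 - E * (v.1 * x.2 + x.1 * v.2), P * v.1)
  have quadratic := ((hasDerivAt_id (0 : 𝕜)).pow 2).smul_const (E * (v.1 * v.2), (0 : Matrix β β 𝕜))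
  refine ((linear.const_add (pairResidual M E P x)).sub quadratic).congr_deriv ?_
  simp

theorem contDiff_matrix_mul [RCLike 𝕜] {α γ Z : Type*} [Fintype α] [Fintype γ]
    [NormedAddCommGroup Z] [NormedSpace 𝕜 Z] {m : WithTop ℕ∞} {f : Z → Matrix α ι 𝕜}
    {g : Z → Matrix ι γ 𝕜} (hf : ContDiff 𝕜 m f) (hg : ContDiff 𝕜 m g) :
    ContDiff 𝕜 m fun z => f z * g z := by
  refine contDiff_pi.2 fun a => contDiff_pi.2 fun c => ContDiff.sum fun b _ => ?_
  exact (contDiff_pi.1 (contDiff_pi.1 hf a) b).mul (contDiff_pi.1 (contDiff_pi.1 hg b) c)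

theorem contDiff_pairResidual [RCLike 𝕜] {Z : Type*} [NormedAddCommGroup Z] [NormedSpace 𝕜 Z]
    {m : WithTop ℕ∞} {M E : Z → Matrix ι ι 𝕜} (hM : ContDiff 𝕜 m M) (hE : ContDiff 𝕜 m E)
    (P : Matrix β ι 𝕜) :
    ContDiff 𝕜 m fun u : Z × (Matrix ι β 𝕜 × Matrix β β 𝕜) =>
      pairResidual (M u.1) (E u.1) P u.2 := by
  have hy : ContDiff 𝕜 m fun u : Z × (Matrix ι β 𝕜 × Matrix β β 𝕜) => u.2.1 := by fun_prop
  have hC : ContDiff 𝕜 m fun u : Z × (Matrix ι β 𝕜 × Matrix β β 𝕜) => u.2.2 := by fun_prop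
  exact ((contDiff_matrix_mul (hM.comp contDiff_fst) hy).sub
    (contDiff_matrix_mul (hE.comp contDiff_fst) (contDiff_matrix_mul hy hC))).prodMk
    ((contDiff_matrix_mul contDiff_const hy).sub contDiff_const)

theorem IsSimpleInvariantPair.exists_curve [RCLike 𝕜] {M E : 𝕜 → Matrix ι ι 𝕜} {P : Matrix β ι 𝕜}
    {y₀ : Matrix ι β 𝕜} {Ω : Matrix β β 𝕜} {z₀ : 𝕜}
    (h : IsSimpleInvariantPair (M z₀) (E z₀) P y₀ Ω)
    (hM : ContDiff 𝕜 1 M) (hE : ContDiff 𝕜 1 E) :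
    ∃ (y : 𝕜 → Matrix ι β 𝕜) (C : 𝕜 → Matrix β β 𝕜),
      (∀ᶠ z in 𝓝 z₀, M z * y z = E z * (y z * C z) ∧ P * y z = 1) ∧
      (fun z => y z - y₀) =O[𝓝 z₀] (fun z => z - z₀) ∧
      (fun z => C z - Ω) =O[𝓝 z₀] fun z => z - z₀ := by
  let F : 𝕜 × (Matrix ι β 𝕜 × Matrix β β 𝕜) → Matrix ι β 𝕜 × Matrix β β 𝕜 :=
    fun u => pairResidual (M u.1) (E u.1) P u.2
  have hF : HasStrictFDerivAt F (fderiv 𝕜 F (z₀, (y₀, Ω))) (z₀, (y₀, Ω)) :=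
    (contDiff_pairResidual hM hE P).contDiffAt.hasStrictFDerivAt one_ne_zero
  have fderiv_apply (v : Matrix ι β 𝕜 × Matrix β β 𝕜) : fderiv 𝕜 F (z₀, (y₀, Ω)) (0, v) =
      (M z₀ * v.1 - E z₀ * (v.1 * Ω + y₀ * v.2), P * v.1) := by
    refine (hF.hasFDerivAt.hasLineDerivAt (0, v)).unique ?_
    simp only [HasLineDerivAt, F, Prod.smul_mk, Prod.mk_add_mk, smul_zero, add_zero]
    exact hasDerivAt_pairResidual (M z₀) (E z₀) P (y₀, Ω) v
  obtain ⟨x, hx, hxO⟩ := exists_implicit_curve hF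
    (pairResidual_eq_zero_iff.2 ⟨h.mul_eq, h.normalized⟩) fun v hv => by
      obtain ⟨hMv, hPv⟩ := Prod.mk_eq_zero.1 ((fderiv_apply v).symm.trans hv)
      exact Prod.mk_eq_zero.2 (h.eq_zero v.1 v.2 (sub_eq_zero.1 hMv) hPv)
  refine ⟨fun z => (x z).1, fun z => (x z).2, ?_, isBigO_prod_left.1 hxO⟩
  filter_upwards [hx] with z hz using pairResidual_eq_zero_iff.1 hz

end Continuation

section Scaling

variable {𝕜 ι β : Type*} [DecidableEq ι]

/-- The diagonal matrix `z ^ w`, which scales row `a` by `z ^ w a`. -/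
def powDiag [CommRing 𝕜] (w : ι → ℕ) (z : 𝕜) : Matrix ι ι 𝕜 :=
  Matrix.diagonal fun a => z ^ w a

theorem powDiag_add_const [CommRing 𝕜] (w : ι → ℕ) (m : ℕ) (z : 𝕜) :
    powDiag (fun a => w a + m) z = z ^ m • powDiag w z := by
  simp only [powDiag, ← Matrix.diagonal_smul, Pi.smul_def, smul_eq_mul, pow_add, mul_comm]

variable [Fintype ι]

theorem powDiag_mul_apply [CommRing 𝕜] (w : ι → ℕ) (z : 𝕜) (V : Matrix ι β 𝕜) (a : ι) (q : β) :
    (powDiag w z * V) a q = z ^ w a * V a q :=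
  Matrix.diagonal_mul _ _ _ _

theorem powDiag_mul_powDiag [CommRing 𝕜] (v w : ι → ℕ) (z : 𝕜) :
    powDiag v z * powDiag w z = powDiag (v + w) z := by
  simp only [powDiag, Matrix.diagonal_mul_diagonal, ← pow_add, Pi.add_apply]

theorem mul_powDiag_eq_powDiag_mul [CommRing 𝕜] {K : Matrix ι ι 𝕜} {v w : ι → ℕ}
    (hK : ∀ a b, K a b ≠ 0 → w b = v a) (z : 𝕜) : K * powDiag w z = powDiag v z * K := by
  ext a b
  rw [powDiag_mul_apply, powDiag, Matrix.mul_diagonal]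
  by_cases h : K a b = 0
  · simp [h]
  · rw [hK a b h, mul_comm]

theorem mul_powDiag_zero_mul {α γ : Type*} [CommRing 𝕜] [Fintype γ] {w : ι → ℕ} {f : γ → ι}
    (hf : Function.Injective f) (hw : ∀ a, a ∈ Set.range f ↔ w a = 0) (B : Matrix α ι 𝕜)
    (V : Matrix ι β 𝕜) :
    B * (powDiag w (0 : 𝕜) * V) = B.submatrix id f * V.submatrix f id := by
  ext a q
  rw [Matrix.mul_apply, Matrix.mul_apply]
  simp only [powDiag_mul_apply, Matrix.submatrix_apply, id_eq]
  refine (Fintype.sum_of_injective f hf _ _ (fun b hb => ?_) fun c => ?_).symm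
  · rw [zero_pow (mt (hw b).2 hb), zero_mul, mul_zero]
  · rw [(hw (f c)).1 ⟨c, rfl⟩, pow_zero, one_mul]

/-- The matrix `z ^ (-v) (K + z ^ ρ B) z ^ w`, where `v = min (w + 1) ρ` is the weight for which
`K z ^ w = z ^ v K`; written this way it is polynomial in `z`. -/
def scaledMat [CommRing 𝕜] (K B : Matrix ι ι 𝕜) (w : ι → ℕ) (ρ : ℕ) (z : 𝕜) : Matrix ι ι 𝕜 :=
  K + powDiag (fun a => ρ - (w a + 1)) z * B * powDiag w z

/-- The matrix `z ^ (-v) z ^ (w + 1)`, with `v = min (w + 1) ρ` as in `scaledMat`. -/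
def scaledId [CommRing 𝕜] (w : ι → ℕ) (ρ : ℕ) (z : 𝕜) : Matrix ι ι 𝕜 :=
  powDiag (fun a => w a + 1 - ρ) z

theorem scaledId_zero_mul_apply [CommRing 𝕜] (w : ι → ℕ) (ρ : ℕ) (T : Matrix ι β 𝕜) (a : ι)
    (q : β) : (scaledId w ρ (0 : 𝕜) * T) a q = if w a + 1 ≤ ρ then T a q else 0 := by
  simp only [scaledId, powDiag_mul_apply, zero_pow_eq, Nat.sub_eq_zero_iff_le, ite_mul, one_mul,
    zero_mul]

theorem scaledMat_zero_mul_apply {γ : Type*} [CommRing 𝕜] [Fintype γ] {w : ι → ℕ} {f : γ → ι}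
    (hf : Function.Injective f) (hw : ∀ a, a ∈ Set.range f ↔ w a = 0) (K B : Matrix ι ι 𝕜) (ρ : ℕ)
    (V : Matrix ι β 𝕜) (a : ι) (q : β) :
    (scaledMat K B w ρ 0 * V) a q =
      (K * V) a q + if ρ ≤ w a + 1 then (B.submatrix id f * V.submatrix f id) a q else 0 := by
  rw [scaledMat, Matrix.add_mul, Matrix.mul_assoc, Matrix.mul_assoc, mul_powDiag_zero_mul hf hw,
    Matrix.add_apply]
  simp only [powDiag_mul_apply, zero_pow_eq, Nat.sub_eq_zero_iff_le, ite_mul, one_mul, zero_mul]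

theorem mul_powDiag_mul_of_scaledMat_mul [CommRing 𝕜] [Fintype β] {K B : Matrix ι ι 𝕜} {w : ι → ℕ}
    {ρ : ℕ} (hK : ∀ a b, K a b ≠ 0 → w b = min (w a + 1) ρ) {z : 𝕜} {y : Matrix ι β 𝕜}
    {C : Matrix β β 𝕜}
    (h : scaledMat K B w ρ z * y = scaledId w ρ z * (y * C)) :
    (K + z ^ ρ • B) * (powDiag w z * y) = powDiag w z * y * (z • C) := by
  let v : ι → ℕ := fun a => min (w a + 1) ρ
  have left_scaling : powDiag v z * powDiag (fun a => ρ - (w a + 1)) z = z ^ ρ • 1 := by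
    have hv : (v + fun a => ρ - (w a + 1)) = fun _ => 0 + ρ := by
      funext a; simp only [v, Pi.add_apply]; omega
    rw [powDiag_mul_powDiag, hv, powDiag_add_const]
    simp [powDiag]
  have right_scaling : powDiag v z * scaledId w ρ z = z • powDiag w z := by
    have hv : (v + fun a => w a + 1 - ρ) = fun a => w a + 1 := by
      funext a; simp only [v, Pi.add_apply]; omega
    rw [scaledId, powDiag_mul_powDiag, hv, powDiag_add_const, pow_one]
  have mul_powDiag : (K + z ^ ρ • B) * powDiag w z = powDiag v z * scaledMat K B w ρ z := by
    rw [scaledMat, Matrix.add_mul, Matrix.mul_add, mul_powDiag_eq_powDiag_mul hK,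
      ← Matrix.mul_assoc (powDiag v z), ← Matrix.mul_assoc (powDiag v z), left_scaling,
      Matrix.smul_mul (z ^ ρ) 1, Matrix.one_mul]
  rw [← Matrix.mul_assoc, mul_powDiag, Matrix.mul_assoc, h, ← Matrix.mul_assoc, right_scaling,
    Matrix.smul_mul, Matrix.mul_smul, Matrix.mul_assoc]

open scoped Matrix.Norms.Elementwise

theorem contDiff_powDiag [RCLike 𝕜] (w : ι → ℕ) {m : WithTop ℕ∞} :
    ContDiff 𝕜 m (powDiag w : 𝕜 → Matrix ι ι 𝕜) := by
  refine contDiff_pi.2 fun a => contDiff_pi.2 fun b => ?_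
  by_cases h : a = b
  · simp only [powDiag, Matrix.diagonal_apply, h, if_true]
    fun_prop
  · simp only [powDiag, Matrix.diagonal_apply, h, if_false]
    fun_prop

theorem contDiff_scaledMat [RCLike 𝕜] (K B : Matrix ι ι 𝕜) (w : ι → ℕ) (ρ : ℕ) {m : WithTop ℕ∞} :
    ContDiff 𝕜 m (scaledMat K B w ρ) :=
  contDiff_const.add <| contDiff_matrix_mul (contDiff_matrix_mul (contDiff_powDiag _)
    contDiff_const) (contDiff_powDiag w)

theorem IsSimpleInvariantPair.exists_scaled_curve [RCLike 𝕜] [Fintype β] [DecidableEq β]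
    {K B : Matrix ι ι 𝕜} {w : ι → ℕ} {ρ : ℕ} {P : Matrix β ι 𝕜} {y₀ : Matrix ι β 𝕜}
    {Ω : Matrix β β 𝕜}
    (h : IsSimpleInvariantPair (scaledMat K B w ρ 0) (scaledId w ρ 0) P y₀ Ω)
    (hK : ∀ a b, K a b ≠ 0 → w b = min (w a + 1) ρ) :
    ∃ (y : 𝕜 → Matrix ι β 𝕜) (C : 𝕜 → Matrix β β 𝕜),
      (∀ᶠ z in 𝓝 0, (K + z ^ ρ • B) * (powDiag w z * y z) = powDiag w z * y z * (z • C z) ∧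
        P * y z = 1) ∧
      (fun z => y z - y₀) =O[𝓝 0] (fun z => z) ∧ (fun z => C z - Ω) =O[𝓝 0] fun z => z := by
  obtain ⟨y, C, hyC, hy, hC⟩ := h.exists_curve (contDiff_scaledMat K B w ρ) (contDiff_powDiag _)
  refine ⟨y, C, ?_, by simpa using hy, by simpa using hC⟩
  filter_upwards [hyC] with z hz using ⟨mul_powDiag_mul_of_scaledMat_mul hK hz.1, hz.2⟩

end Scaling

section Asymptotics

open Asymptotics
open scoped Matrix.Norms.Elementwise

variable {𝕜 ι β : Type*} [RCLike 𝕜] [Fintype ι] [Fintype β]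

theorem isBigO_entry {Z : Type*} {l : Filter Z} {M : Z → Matrix ι β 𝕜}
    {g : Z → 𝕜} (h : M =O[l] g) (a : ι) (q : β) : (fun z => M z a q) =O[l] g :=
  isBigO_pi.1 (isBigO_pi.1 h a) q

variable [DecidableEq ι] {y : 𝕜 → Matrix ι β 𝕜} {y₀ : Matrix ι β 𝕜}

theorem isBigO_powDiag_mul_sub_pow_mul
    (hy : (fun z => y z - y₀) =O[𝓝 0] fun z => z) (w : ι → ℕ) (a : ι) (q : β) :
    (fun z => (powDiag w z * y z) a q - z ^ w a * y₀ a q) =O[𝓝 0] fun z => z ^ (w a + 1) := by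
  simp only [powDiag_mul_apply, ← mul_sub, pow_succ]
  exact (isBigO_refl _ _).mul (isBigO_entry hy a q)

/-- The difference between the scaled curve `z ^ w y(z)` and its value at `z = 0`, in which only
the rows of weight `0` survive. -/
def deviation (w : ι → ℕ) (y : 𝕜 → Matrix ι β 𝕜) (y₀ : Matrix ι β 𝕜) (z : 𝕜) : Matrix ι β 𝕜 :=
  powDiag w z * y z - powDiag w (0 : 𝕜) * y₀

theorem isBigO_deviation
    (hy : (fun z => y z - y₀) =O[𝓝 0] fun z => z) (w : ι → ℕ) (a : ι) (q : β) :
    (fun z => deviation w y y₀ z a q) =O[𝓝 0] fun z => z ^ max 1 (w a) := by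
  have remainder := isBigO_powDiag_mul_sub_pow_mul hy w a q
  simp only [deviation, Matrix.sub_apply, powDiag_mul_apply w (0 : 𝕜)]
  obtain hw | hw := Nat.eq_zero_or_pos (w a)
  · simpa [hw] using remainder
  · rw [zero_pow hw.ne', max_eq_right hw]
    have leading : (fun z : 𝕜 => y₀ a q * z ^ w a) =O[𝓝 0] fun z => z ^ w a :=
      (isBigO_refl _ _).const_mul_left _
    simpa [mul_comm] using
      (remainder.trans (isLittleO_pow_pow (Nat.lt_succ_self _)).isBigO).add leading

end Asymptotics

section Root

open Asymptotics

/-- The real `ρ`-th root of `t ≥ 0`, as a complex number. -/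
noncomputable def root (ρ : ℕ) (t : ℝ) : ℂ := ((t ^ (1 / (ρ : ℝ)) : ℝ) : ℂ)

variable {ρ : ℕ}

theorem root_pow {t : ℝ} (hρ : ρ ≠ 0) (ht : 0 ≤ t) : root ρ t ^ ρ = t := by
  rw [root, ← Complex.ofReal_pow, one_div, Real.rpow_inv_natCast_pow ht hρ]

theorem root_ne_zero {t : ℝ} (ht : 0 < t) : root ρ t ≠ 0 :=
  Complex.ofReal_ne_zero.2 (Real.rpow_pos_of_pos ht _).ne'

theorem norm_root_pow {t : ℝ} (ht : 0 ≤ t) (m : ℕ) : ‖root ρ t ^ m‖ = t ^ ((m : ℝ) / ρ) := by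
  rw [root, ← Complex.ofReal_pow, ← Real.rpow_mul_natCast ht, Complex.norm_real,
    Real.norm_of_nonneg (Real.rpow_nonneg ht _), one_div_mul_eq_div]

theorem tendsto_root (hρ : ρ ≠ 0) : Tendsto (root ρ) (𝓝[>] 0) (𝓝 0) := by
  have hρ' : (0 : ℝ) < 1 / (ρ : ℝ) := by positivity
  have rpow_tendsto : Tendsto (fun t : ℝ => t ^ (1 / (ρ : ℝ))) (𝓝 0) (𝓝 0) := by
    have := (Real.continuousAt_rpow_const (0 : ℝ) _ (Or.inr hρ'.le)).tendsto
    rwa [Real.zero_rpow hρ'.ne'] at this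
  exact (Complex.continuous_ofReal.tendsto' 0 0 Complex.ofReal_zero).comp
    (rpow_tendsto.mono_left nhdsWithin_le_nhds)

theorem matBigO_comp_root {α β : Type*} {M : ℂ → Matrix α β ℂ} {m : ℕ} (hρ : ρ ≠ 0)
    (hM : ∀ a b, (fun z => M z a b) =O[𝓝 0] fun z => z ^ m) :
    MatBigO (fun t => M (root ρ t)) (m / ρ) := by
  refine fun a b => ((hM a b).comp_tendsto (tendsto_root hρ)).trans (IsBigO.of_norm_eventuallyLE ?_)
  filter_upwards [self_mem_nhdsWithin] with t ht
  exact (norm_root_pow (le_of_lt ht) m).le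

theorem MatBigO.const_mul {α β γ : Type*} [Fintype β] {M : ℝ → Matrix β γ ℂ} {c : ℝ}
    (hM : MatBigO M c) (B : Matrix α β ℂ) : MatBigO (fun t => B * M t) c := fun a q => by
  simp only [Matrix.mul_apply]
  exact IsBigO.fun_sum fun b _ => (hM b q).const_mul_left _

end Root

theorem rank_eq_card_of_mul_eq_one {𝕜 α β : Type*} [Field 𝕜] [Fintype α] [Fintype β]
    [DecidableEq β] {L : Matrix β α 𝕜} {H : Matrix α β 𝕜} (h : L * H = 1) :
    H.rank = Fintype.card β := by
  refine le_antisymm (Matrix.rank_le_card_width H) ?_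
  simpa [h] using Matrix.rank_mul_le_right L H

section Schur

variable {n k r : ℕ} {s : ℕ → ℕ} {β : Type*}

/-- Splits the rows of the blocks `ρ, …, k` into those of block `ρ` and those of `ρ + 1, …, k`. -/
noncomputable def tailEquiv (s : ℕ → ℕ) (ρ : BlockSize k) :
    Fin (s ρ.1) ⊕ TailIdx k s (ρ.1 + 1) ≃ TailIdx k s ρ.1 := by
  refine Equiv.ofBijective (Sum.elim (fun x => ⟨⟨ρ, le_rfl⟩, x⟩)
    fun c => ⟨⟨c.1.1, Nat.le_of_succ_le c.1.2⟩, c.2⟩)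
    ⟨Function.Injective.sumElim ?_ ?_ ?_, ?_⟩
  · intro x y h
    simpa using h
  · rintro ⟨⟨i, hi⟩, x⟩ ⟨⟨j, hj⟩, y⟩ h
    simpa using h
  · rintro x ⟨⟨i, hi⟩, y⟩ h
    obtain rfl : ρ = i := congrArg (fun c : TailIdx k s ρ.1 => c.1.1) h
    exact absurd hi (Nat.not_succ_le_self _)
  · rintro ⟨⟨i, hi⟩, x⟩
    obtain h | h := Nat.lt_or_eq_of_le hi
    · exact ⟨Sum.inr ⟨⟨i, h⟩, x⟩, rfl⟩
    · obtain rfl : ρ = i := Subtype.ext h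
      exact ⟨Sum.inl x, rfl⟩

variable {D : Matrix (Fin n) (Fin n) ℂ} {Xi Sg : Matrix (Fin n) (JordanIdx k s) ℂ}
  {ρ : BlockSize k}

theorem stackI_submatrix_tailEquiv (G : Matrix (TailIdx k s (ρ.1 + 1)) (Fin (s ρ.1)) ℂ) :
    (stackI ρ G).submatrix (tailEquiv s ρ) id = Matrix.fromRows 1 G := by
  ext (x | c) y
  · refine (dif_neg (Nat.not_succ_le_self _)).trans ?_
    simp only [Matrix.fromRows_apply_inl, Matrix.one_apply, Fin.ext_iff]
    rfl
  · exact dif_pos c.1.2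

theorem matW_submatrix_tailEquiv :
    (matW D Xi Sg ρ.1).submatrix (tailEquiv s ρ) (tailEquiv s ρ) =
      Matrix.fromBlocks
        ((subCol Sg ρ (lastPos ρ)).conjTranspose * D * subCol Xi ρ (firstPos ρ))
        ((subCol Sg ρ (lastPos ρ)).conjTranspose * D * firstCols Xi (ρ.1 + 1))
        ((lastCols Sg (ρ.1 + 1)).conjTranspose * D * subCol Xi ρ (firstPos ρ))
        (matW D Xi Sg (ρ.1 + 1)) := by
  ext (x | c) (y | d) <;> rfl

theorem matW_mul_submatrix_tailEquiv (U : Matrix (TailIdx k s ρ.1) β ℂ) :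
    (matW D Xi Sg ρ.1 * U).submatrix (tailEquiv s ρ) id =
      (matW D Xi Sg ρ.1).submatrix (tailEquiv s ρ) (tailEquiv s ρ) *
        U.submatrix (tailEquiv s ρ) id :=
  (Matrix.submatrix_mul_equiv _ _ _ (tailEquiv s ρ) _).symm

theorem isUnit_matS (hW : IsUnit (matW D Xi Sg ρ.1)) (hW' : IsUnit (matW D Xi Sg (ρ.1 + 1))) :
    IsUnit (matS D Xi Sg ρ) := by
  have := hW'.invertible
  rw [← Matrix.isUnit_submatrix_equiv (tailEquiv s ρ) (tailEquiv s ρ), matW_submatrix_tailEquiv,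
    Matrix.isUnit_fromBlocks_iff_of_invertible₂₂, Matrix.invOf_eq_nonsing_inv] at hW
  rwa [matS, matG, Matrix.mul_neg, ← sub_eq_add_neg, ← Matrix.mul_assoc]

theorem matW_mul_stackI (hW' : IsUnit (matW D Xi Sg (ρ.1 + 1))) :
    (matW D Xi Sg ρ.1 * stackI ρ (matG D Xi Sg ρ)).submatrix (tailEquiv s ρ) id =
      Matrix.fromRows (matS D Xi Sg ρ) 0 := by
  have lower : (lastCols Sg (ρ.1 + 1)).conjTranspose * D * subCol Xi ρ (firstPos ρ) +
      matW D Xi Sg (ρ.1 + 1) * matG D Xi Sg ρ = 0 := by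
    rw [matG, Matrix.mul_neg, Matrix.mul_nonsing_inv_cancel_left _ _
      ((Matrix.isUnit_iff_isUnit_det _).1 hW'), add_neg_cancel]
  rw [matW_mul_submatrix_tailEquiv, matW_submatrix_tailEquiv, stackI_submatrix_tailEquiv,
    Matrix.fromBlocks_mul_fromRows, Matrix.mul_one, Matrix.mul_one, lower, matS]

theorem eq_stackI_mul (hW' : IsUnit (matW D Xi Sg (ρ.1 + 1))) {U : Matrix (TailIdx k s ρ.1) β ℂ}
    (hU : ∀ c q, (matW D Xi Sg ρ.1 * U) (tailEquiv s ρ (Sum.inr c)) q = 0) :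
    U = stackI ρ (matG D Xi Sg ρ) * U.submatrix (tailEquiv s ρ ∘ Sum.inl) id := by
  let U₁ := U.submatrix (tailEquiv s ρ ∘ Sum.inl) id
  let U₂ := U.submatrix (tailEquiv s ρ ∘ Sum.inr) id
  have split : U.submatrix (tailEquiv s ρ) id = Matrix.fromRows U₁ U₂ := by ext (_ | _) _ <;> rfl
  have lower : (lastCols Sg (ρ.1 + 1)).conjTranspose * D * subCol Xi ρ (firstPos ρ) * U₁ +
      matW D Xi Sg (ρ.1 + 1) * U₂ = 0 := by
    ext c q
    have := congrFun₂ (matW_mul_submatrix_tailEquiv (D := D) (Xi := Xi) (Sg := Sg) U) (Sum.inr c) q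
    rw [matW_submatrix_tailEquiv, split, Matrix.fromBlocks_mul_fromRows] at this
    exact this.symm.trans (hU c q)
  have eq_matG_mul : U₂ = matG D Xi Sg ρ * U₁ := by
    rw [matG, Matrix.neg_mul, Matrix.mul_assoc, eq_neg_of_add_eq_zero_left lower, Matrix.mul_neg,
      neg_neg, Matrix.nonsing_inv_mul_cancel_left _ _ ((Matrix.isUnit_iff_isUnit_det _).1 hW')]
  have : U.submatrix (tailEquiv s ρ) id =
      (stackI ρ (matG D Xi Sg ρ)).submatrix (tailEquiv s ρ) id * U₁ := by
    rw [split, stackI_submatrix_tailEquiv, Matrix.fromRows_mul, Matrix.one_mul, eq_matG_mul]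
  ext c q
  obtain ⟨b, rfl⟩ := (tailEquiv s ρ).surjective c
  exact congrFun₂ this b q

theorem matTheta_mul_apply_of_lt (Ψ : Matrix (Fin ρ.1 × Fin (s ρ.1)) β ℂ) {m : ℕ}
    (hm : m + 1 < ρ.1) (x : Fin (s ρ.1)) (q : β) :
    (matTheta D Xi Sg ρ * Ψ) (⟨m, Nat.lt_of_succ_lt hm⟩, x) q = Ψ (⟨m + 1, hm⟩, x) q := by
  have ne_lastPos : (⟨m, Nat.lt_of_succ_lt hm⟩ : Fin ρ.1) ≠ lastPos ρ := by
    simp only [lastPos, ne_eq, Fin.mk.injEq]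
    omega
  rw [Matrix.mul_apply, Fintype.sum_eq_single (⟨m + 1, hm⟩, x)]
  · simp [matTheta]
  · rintro ⟨l, y⟩ hly
    have : m + 1 = l.1 → x ≠ y := fun hl hx => hly (by simp [hl, hx])
    simp only [matTheta, Matrix.of_apply, ne_lastPos, false_and, if_false]
    split_ifs with hl hx
    · exact absurd hx (this hl)
    all_goals exact zero_mul _

theorem matTheta_mul_apply_lastPos (Ψ : Matrix (Fin ρ.1 × Fin (s ρ.1)) (Fin r) ℂ)
    (x : Fin (s ρ.1)) (q : Fin r) :
    (matTheta D Xi Sg ρ * Ψ) (lastPos ρ, x) q = (matS D Xi Sg ρ * topBlock ρ Ψ) x q := by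
  have not_succ (l : Fin ρ.1) : ρ.1 - 1 + 1 ≠ l.1 := by omega
  rw [Matrix.mul_apply, Fintype.sum_prod_type, Fintype.sum_eq_single (firstPos ρ)]
  · simp only [matTheta, Matrix.of_apply, lastPos, not_succ, and_self, if_true, if_false]
    rfl
  · intro l hl
    simp [matTheta, lastPos, not_succ, hl]

theorem eq_topBlock_mul_pow {Ω : Matrix (Fin r) (Fin r) ℂ}
    {Φ : Matrix (Fin ρ.1 × Fin (s ρ.1)) (Fin r) ℂ} (hΦ : matTheta D Xi Sg ρ * Φ = Φ * Ω)
    (m : Fin ρ.1) (x : Fin (s ρ.1)) (q : Fin r) : Φ (m, x) q = (topBlock ρ Φ * Ω ^ m.1) x q := by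
  obtain ⟨m, hm⟩ := m
  induction m generalizing q with
  | zero => simp [topBlock, firstPos]
  | succ m ih =>
    rw [← matTheta_mul_apply_of_lt (D := D) (Xi := Xi) (Sg := Sg) Φ hm x q, hΦ, pow_succ,
      ← Matrix.mul_assoc, Matrix.mul_apply, Matrix.mul_apply]
    exact Finset.sum_congr rfl fun c _ => by rw [ih]

theorem matS_mul_topBlock {Ω : Matrix (Fin r) (Fin r) ℂ}
    {Φ : Matrix (Fin ρ.1 × Fin (s ρ.1)) (Fin r) ℂ} (hΦ : matTheta D Xi Sg ρ * Φ = Φ * Ω) :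
    matS D Xi Sg ρ * topBlock ρ Φ = topBlock ρ Φ * Ω ^ ρ.1 := by
  ext x q
  rw [← matTheta_mul_apply_lastPos, hΦ, ← pow_sub_one_mul ρ.pos.ne' Ω, ← Matrix.mul_assoc,
    Matrix.mul_apply, Matrix.mul_apply]
  exact Finset.sum_congr rfl fun c _ => by rw [eq_topBlock_mul_pow hΦ]; rfl

theorem isUnit_of_matTheta_mul (hS : IsUnit (matS D Xi Sg ρ)) {Ω : Matrix (Fin r) (Fin r) ℂ}
    {Φ : Matrix (Fin ρ.1 × Fin (s ρ.1)) (Fin r) ℂ} (hΦ : matTheta D Xi Sg ρ * Φ = Φ * Ω)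
    {P : Matrix (Fin r) (Fin ρ.1 × Fin (s ρ.1)) ℂ} (hP : P * Φ = 1) : IsUnit Ω := by
  let Φ' : Matrix (Fin ρ.1 × Fin (s ρ.1)) (Fin r) ℂ := Matrix.of fun a q =>
    if a.1.1 = 0 then ((matS D Xi Sg ρ)⁻¹ * (topBlock ρ Φ * Ω ^ (ρ.1 - 1))) a.2 q
    else (topBlock ρ Φ * Ω ^ (a.1.1 - 1)) a.2 q
  have hΦ' : Φ' * Ω = Φ := by
    ext ⟨⟨m, hm⟩, x⟩ q
    rw [eq_topBlock_mul_pow hΦ]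
    cases m with
    | zero =>
      change ((matS D Xi Sg ρ)⁻¹ * (topBlock ρ Φ * Ω ^ (ρ.1 - 1)) * Ω) x q = _
      rw [Matrix.mul_assoc, Matrix.mul_assoc, pow_sub_one_mul ρ.pos.ne', ← matS_mul_topBlock hΦ,
        Matrix.nonsing_inv_mul_cancel_left _ _ ((Matrix.isUnit_iff_isUnit_det _).1 hS), pow_zero,
        Matrix.mul_one]
    | succ m =>
      change (topBlock ρ Φ * Ω ^ m * Ω) x q = _
      rw [Matrix.mul_assoc, ← pow_succ]
  exact IsUnit.of_mul_eq_one_right (P * Φ') (by rw [Matrix.mul_assoc, hΦ', hP])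

end Schur

section JordanForm

variable {k : ℕ} {s : ℕ → ℕ} {κ β : Type*}

/-- The index, among all rows in the basis `[Ξ Ξ_c]`, of a row of the block `Ξ_i`. -/
def chainIdx (κ : Type*) (i : BlockSize k) (x : Fin i.1 × Fin (s i.1)) : JordanIdx k s ⊕ κ :=
  Sum.inl ⟨i, x⟩

/-- The rows at the first positions of the chains of length at least `j`. -/
def firstIdx (κ : Type*) {j : ℕ} (c : TailIdx k s j) : JordanIdx k s ⊕ κ :=
  chainIdx κ c.1.1 (firstPos c.1.1, c.2)

/-- The rows at the last positions of the chains of length at least `j`. -/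
def lastIdx (κ : Type*) {j : ℕ} (c : TailIdx k s j) : JordanIdx k s ⊕ κ :=
  chainIdx κ c.1.1 (lastPos c.1.1, c.2)

/-- The power of `t ^ (1 / ρ)` by which each row of `[Ξ Ξ_c]⁻¹ H` is scaled. -/
def weight (s : ℕ → ℕ) (κ : Type*) (ρ : BlockSize k) : JordanIdx k s ⊕ κ → ℕ :=
  Sum.elim (fun a => if a.1.1 ≤ ρ.1 then ρ.1 - a.1.1 + a.2.1 else min a.2.1 ρ.1) fun _ => ρ.1

theorem weight_chainIdx_of_le {i ρ : BlockSize k} (hi : i.1 ≤ ρ.1) (x : Fin i.1 × Fin (s i.1)) :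
    weight s κ ρ (chainIdx κ i x) = ρ.1 - i.1 + x.1 :=
  if_pos hi

theorem weight_chainIdx_of_lt {i ρ : BlockSize k} (hi : ρ.1 < i.1) (x : Fin i.1 × Fin (s i.1)) :
    weight s κ ρ (chainIdx κ i x) = min (x.1 : ℕ) ρ.1 :=
  if_neg hi.not_ge

theorem chainIdx_injective (i : BlockSize k) :
    Function.Injective (chainIdx κ i : Fin i.1 × Fin (s i.1) → JordanIdx k s ⊕ κ) :=
  Sum.inl_injective.comp sigma_mk_injective

theorem firstIdx_injective (j : ℕ) :
    Function.Injective (firstIdx κ : TailIdx k s j → JordanIdx k s ⊕ κ) := by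
  rintro ⟨⟨i, hi⟩, x⟩ ⟨⟨l, hl⟩, y⟩ h
  simp only [firstIdx, chainIdx, Sum.inl.injEq, Sigma.mk.injEq] at h
  obtain ⟨rfl, h⟩ := h
  rw [(Prod.mk.inj (eq_of_heq h)).2]

theorem mem_range_firstIdx_iff (ρ : BlockSize k) (a : JordanIdx k s ⊕ κ) :
    a ∈ Set.range (firstIdx κ : TailIdx k s ρ.1 → _) ↔ weight s κ ρ a = 0 := by
  constructor
  · rintro ⟨⟨⟨i, hi⟩, x⟩, rfl⟩
    obtain h | h := hi.eq_or_lt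
    · exact (weight_chainIdx_of_le h.ge _).trans (by simp [h, firstPos])
    · exact (weight_chainIdx_of_lt h _).trans (by simp [firstPos])
  · intro ha
    obtain ⟨i, m, x⟩ | a := a
    · have hm : m.1 < i.1 := m.2
      have : ρ.1 ≤ i.1 ∧ m.1 = 0 := by
        simp only [weight, Sum.elim_inl] at ha
        have := ρ.pos
        split_ifs at ha <;> omega
      obtain rfl : m = firstPos i := Fin.ext this.2
      exact ⟨⟨⟨i, this.1⟩, x⟩, rfl⟩
    · exact absurd ha ρ.pos.ne'

theorem chainIdx_notMem_range {i ρ : BlockSize k} (h : i ≠ ρ) (x : Fin i.1 × Fin (s i.1)) :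
    chainIdx κ i x ∉ Set.range (chainIdx κ ρ) := by
  rintro ⟨y, hy⟩
  exact h (congrArg Sigma.fst (Sum.inl_injective hy)).symm

theorem nilp_mul_apply_of_lt (V : Matrix (JordanIdx k s) β ℂ) (i : BlockSize k) {m : ℕ}
    (hm : m + 1 < i.1) (x : Fin (s i.1)) (q : β) :
    (nilp k s * V) ⟨i, (⟨m, Nat.lt_of_succ_lt hm⟩, x)⟩ q = V ⟨i, (⟨m + 1, hm⟩, x)⟩ q := by
  rw [Matrix.mul_apply, Fintype.sum_eq_single ⟨i, (⟨m + 1, hm⟩, x)⟩]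
  · simp [nilp]
  · rintro ⟨j, l, y⟩ hne
    by_cases hij : i = j
    · subst hij
      have : ¬(m + 1 = l.1 ∧ x = y) := by
        rintro ⟨hl, rfl⟩
        exact hne (by simp [hl])
      simp [nilp, this]
    · rw [nilp, Matrix.blockDiagonal'_apply_ne _ _ _ hij, zero_mul]

theorem nilp_mul_apply_lastPos (V : Matrix (JordanIdx k s) β ℂ) (i : BlockSize k)
    (x : Fin (s i.1)) (q : β) : (nilp k s * V) ⟨i, (lastPos i, x)⟩ q = 0 := by
  rw [Matrix.mul_apply]
  refine Fintype.sum_eq_zero _ ?_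
  rintro ⟨j, l, y⟩
  by_cases hij : i = j
  · subst hij
    have : i.1 - 1 + 1 ≠ l.1 := by omega
    simp [nilp, lastPos, this]
  · rw [nilp, Matrix.blockDiagonal'_apply_ne _ _ _ hij, zero_mul]

theorem weight_eq_of_nilp_ne_zero {ρ : BlockSize k} {a b : JordanIdx k s} (h : nilp k s a b ≠ 0) :
    weight s κ ρ (Sum.inl b) = min (weight s κ ρ (Sum.inl a) + 1) ρ.1 := by
  obtain ⟨i, m, x⟩ := a
  obtain ⟨j, l, y⟩ := b
  by_cases hij : i = j
  · subst hij
    have hl : m.1 + 1 = l.1 := by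
      simp only [nilp, Matrix.blockDiagonal'_apply_eq, Matrix.of_apply, ne_eq, ite_eq_right_iff,
        Classical.not_imp] at h
      exact h.1.1
    have := l.2
    simp only [weight, Sum.elim_inl]
    split_ifs <;> omega
  · exact absurd (Matrix.blockDiagonal'_apply_ne _ _ _ hij) h

/-- The unperturbed matrix `diag(N, R)` in the basis `[Ξ Ξ_c]`, after subtracting `λ₀`. -/
def jordanForm (k : ℕ) (s : ℕ → ℕ) (R : Matrix κ κ ℂ) :
    Matrix (JordanIdx k s ⊕ κ) (JordanIdx k s ⊕ κ) ℂ :=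
  Matrix.fromBlocks (nilp k s) 0 0 R

theorem weight_eq_of_jordanForm_ne_zero {R : Matrix κ κ ℂ} (ρ : BlockSize k)
    (a b : JordanIdx k s ⊕ κ) (h : jordanForm k s R a b ≠ 0) :
    weight s κ ρ b = min (weight s κ ρ a + 1) ρ.1 := by
  obtain a | a := a <;> obtain b | b := b
  · exact weight_eq_of_nilp_ne_zero h
  · exact absurd rfl h
  · exact absurd rfl h
  · simp [weight]

variable [Fintype κ] {R : Matrix κ κ ℂ}

theorem jordanForm_mul (V : Matrix (JordanIdx k s ⊕ κ) β ℂ) :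
    jordanForm k s R * V =
      Matrix.fromRows (nilp k s * V.submatrix Sum.inl id) (R * V.submatrix Sum.inr id) := by
  have split : V = Matrix.fromRows (V.submatrix Sum.inl id) (V.submatrix Sum.inr id) :=
    (Matrix.fromRows_toRows V).symm
  conv_lhs => rw [split, jordanForm, Matrix.fromBlocks_mul_fromRows, Matrix.zero_mul,
    Matrix.zero_mul, add_zero, zero_add]

theorem jordanForm_mul_chainIdx_of_lt (V : Matrix (JordanIdx k s ⊕ κ) β ℂ) (i : BlockSize k) {m : ℕ}
    (hm : m + 1 < i.1) (x : Fin (s i.1)) (q : β) :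
    (jordanForm k s R * V) (chainIdx κ i (⟨m, Nat.lt_of_succ_lt hm⟩, x)) q =
      V (chainIdx κ i (⟨m + 1, hm⟩, x)) q := by
  rw [jordanForm_mul]
  exact nilp_mul_apply_of_lt (V.submatrix Sum.inl id) i hm x q

theorem jordanForm_mul_chainIdx_lastPos (V : Matrix (JordanIdx k s ⊕ κ) β ℂ) (i : BlockSize k)
    (x : Fin (s i.1)) (q : β) :
    (jordanForm k s R * V) (chainIdx κ i (lastPos i, x)) q = 0 := by
  rw [jordanForm_mul]
  exact nilp_mul_apply_lastPos (V.submatrix Sum.inl id) i x q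

end JordanForm

section KernelOfJordanForm

variable {k : ℕ} {s : ℕ → ℕ} {κ β : Type*} [Fintype κ] {R : Matrix κ κ ℂ}
  {V : Matrix (JordanIdx k s ⊕ κ) β ℂ} {i ρ : BlockSize k}

theorem chain_eq_zero_of_firstPos_eq_zero (hfirst : ∀ x q, V (chainIdx κ i (firstPos i, x)) q = 0)
    (h : ∀ x, (∀ q, V (chainIdx κ i x) q = 0) →
      ∀ q, (jordanForm k s R * V) (chainIdx κ i x) q = 0)
    (x : Fin i.1 × Fin (s i.1)) (q : β) : V (chainIdx κ i x) q = 0 := by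
  obtain ⟨⟨m, hm⟩, x⟩ := x
  induction m generalizing q with
  | zero => exact hfirst x q
  | succ m ih => rw [← jordanForm_mul_chainIdx_of_lt (R := R) V i hm, h _ fun q => ih q _]

variable [Fintype β] [DecidableEq β] {Ω : Matrix β β ℂ}

theorem row_eq_zero_of_mul_row_eq_zero {𝕜 ι : Type*} [CommRing 𝕜] {Ω : Matrix β β 𝕜}
    (hΩ : IsUnit Ω) {V : Matrix ι β 𝕜} {a : ι} (h : ∀ q, (V * Ω) a q = 0) (q : β) : V a q = 0 := by
  rw [← Matrix.mul_nonsing_inv_cancel_right Ω V ((Matrix.isUnit_iff_isUnit_det _).1 hΩ),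
    Matrix.mul_apply]
  exact Fintype.sum_eq_zero _ fun j => by rw [h, zero_mul]

theorem chain_eq_zero_of_jordanForm_mul_eq_mul (hΩ : IsUnit Ω)
    (h : ∀ x q, (jordanForm k s R * V) (chainIdx κ i x) q = (V * Ω) (chainIdx κ i x) q)
    (x : Fin i.1 × Fin (s i.1)) (q : β) : V (chainIdx κ i x) q = 0 := by
  obtain ⟨⟨m, hm'⟩, x⟩ := x
  have hm : m ≤ i.1 - 1 := Nat.le_sub_one_of_lt hm'
  revert q
  induction hm using Nat.decreasingInduction with
  | self =>
    refine row_eq_zero_of_mul_row_eq_zero hΩ fun q => ?_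
    rw [← h]
    exact jordanForm_mul_chainIdx_lastPos V i x q
  | of_succ m hm ih =>
    have hm : m + 1 < i.1 := Nat.add_lt_of_lt_sub hm
    refine row_eq_zero_of_mul_row_eq_zero hΩ fun q => ?_
    rw [← h, jordanForm_mul_chainIdx_of_lt V i hm, ih hm]

variable [DecidableEq κ]

theorem eq_zero_of_jordanForm_mul_eq (hR : IsUnit R) (hΩ : IsUnit Ω)
    (hchain : V.submatrix (chainIdx κ ρ) id = 0)
    (hfirst : V.submatrix (firstIdx κ : TailIdx k s ρ.1 → _) id = 0)
    (hV : ∀ a ∉ Set.range (chainIdx κ ρ), ∀ q, (jordanForm k s R * V) a q =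
      if weight s κ ρ a + 1 ≤ ρ.1 then (V * Ω) a q else 0) : V = 0 := by
  have inr_eq_zero : V.submatrix Sum.inr id = 0 := by
    have : R * V.submatrix Sum.inr id = 0 := by
      ext a q
      have := hV (Sum.inr a) (by simp [chainIdx]) q
      rwa [if_neg (by simp [weight]), jordanForm_mul] at this
    rw [← Matrix.nonsing_inv_mul_cancel_left R (V.submatrix Sum.inr id)
      ((Matrix.isUnit_iff_isUnit_det _).1 hR), this, Matrix.mul_zero]
  have chain_eq_zero (i : BlockSize k) (x : Fin i.1 × Fin (s i.1)) (q : β) :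
      V (chainIdx κ i x) q = 0 := by
    obtain hi | hi | hi := lt_trichotomy i ρ
    · refine chain_eq_zero_of_jordanForm_mul_eq_mul (R := R) hΩ (fun y q => ?_) x q
      rw [hV _ (chainIdx_notMem_range hi.ne y), if_pos]
      have : i.1 < ρ.1 := hi
      have := y.1.2
      rw [weight_chainIdx_of_le (le_of_lt hi)]
      omega
    · subst hi
      exact congrFun₂ hchain x q
    · refine chain_eq_zero_of_firstPos_eq_zero (R := R)
        (fun y q => congrFun₂ hfirst ⟨⟨i, le_of_lt hi⟩, y⟩ q) (fun y hy q => ?_) x q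
      rw [hV _ (chainIdx_notMem_range hi.ne' y)]
      split_ifs with hw
      · rw [Matrix.mul_apply]
        exact Fintype.sum_eq_zero _ fun j => by rw [hy, zero_mul]
      · rfl
  ext (⟨i, x⟩ | a) q
  · exact chain_eq_zero i x q
  · exact congrFun₂ inr_eq_zero a q

end KernelOfJordanForm

section LimitPencil

variable {n k r : ℕ} {s : ℕ → ℕ} {κ : Type*} [Fintype κ] [DecidableEq κ] {R : Matrix κ κ ℂ}
  {B : Matrix (JordanIdx k s ⊕ κ) (JordanIdx k s ⊕ κ) ℂ} {D : Matrix (Fin n) (Fin n) ℂ}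
  {Xi Sg : Matrix (Fin n) (JordanIdx k s) ℂ} {ρ : BlockSize k}

theorem scaledMat_zero_mul_lastIdx (hB : B.submatrix (lastIdx κ) (firstIdx κ) = matW D Xi Sg ρ.1)
    {β : Type*} (V : Matrix (JordanIdx k s ⊕ κ) β ℂ) (c : TailIdx k s ρ.1) (q : β) :
    (scaledMat (jordanForm k s R) B (weight s κ ρ) ρ.1 0 * V) (lastIdx κ c) q =
      (matW D Xi Sg ρ.1 * V.submatrix (firstIdx κ : TailIdx k s ρ.1 → _) id) c q := by
  have hc : ρ.1 ≤ weight s κ ρ (lastIdx κ c) + 1 := by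
    have : ρ.1 ≤ c.1.1.1 := c.1.2
    simp only [weight, lastIdx, chainIdx, lastPos, Sum.elim_inl]
    split_ifs <;> omega
  rw [scaledMat_zero_mul_apply (firstIdx_injective _) (mem_range_firstIdx_iff ρ), if_pos hc, ← hB,
    lastIdx, jordanForm_mul_chainIdx_lastPos, zero_add]
  rfl

theorem firstIdx_rows_eq_stackI_mul
    (hB : B.submatrix (lastIdx κ) (firstIdx κ) = matW D Xi Sg ρ.1)
    (hW' : IsUnit (matW D Xi Sg (ρ.1 + 1))) {V T : Matrix (JordanIdx k s ⊕ κ) (Fin r) ℂ}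
    (h : ∀ a ∉ Set.range (chainIdx κ ρ), ∀ q,
      (scaledMat (jordanForm k s R) B (weight s κ ρ) ρ.1 0 * V) a q =
        (scaledId (weight s κ ρ) ρ.1 (0 : ℂ) * T) a q) :
    V.submatrix (firstIdx κ) id =
      stackI ρ (matG D Xi Sg ρ) * topBlock ρ (V.submatrix (chainIdx κ ρ) id) := by
  refine eq_stackI_mul hW' fun c q => ?_
  have hc : ρ.1 < c.1.1.1 := c.1.2
  have hw : weight s κ ρ (lastIdx κ (tailEquiv s ρ (Sum.inr c))) = ρ.1 :=
    (weight_chainIdx_of_lt hc _).trans (min_eq_right (Nat.le_sub_one_of_lt hc))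
  rw [← scaledMat_zero_mul_lastIdx (R := R) hB, h, scaledId_zero_mul_apply, hw,
    if_neg (Nat.not_succ_le_self _)]
  exact chainIdx_notMem_range (fun h => hc.ne (congrArg Subtype.val h).symm) _

theorem scaledMat_zero_mul_sub_submatrix_chainIdx
    (hB : B.submatrix (lastIdx κ) (firstIdx κ) = matW D Xi Sg ρ.1)
    (hW' : IsUnit (matW D Xi Sg (ρ.1 + 1))) {V T : Matrix (JordanIdx k s ⊕ κ) (Fin r) ℂ}
    (h : ∀ a ∉ Set.range (chainIdx κ ρ), ∀ q,
      (scaledMat (jordanForm k s R) B (weight s κ ρ) ρ.1 0 * V) a q =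
        (scaledId (weight s κ ρ) ρ.1 (0 : ℂ) * T) a q) :
    (scaledMat (jordanForm k s R) B (weight s κ ρ) ρ.1 0 * V -
        scaledId (weight s κ ρ) ρ.1 (0 : ℂ) * T).submatrix (chainIdx κ ρ) id =
      matTheta D Xi Sg ρ * V.submatrix (chainIdx κ ρ) id - T.submatrix (chainIdx κ ρ) id := by
  ext ⟨m, x⟩ q
  have hw : weight s κ ρ (chainIdx κ ρ (m, x)) = m := by
    rw [weight_chainIdx_of_le le_rfl, Nat.sub_self, zero_add]
  simp only [Matrix.submatrix_apply, Matrix.sub_apply, id_eq]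
  rw [scaledId_zero_mul_apply, hw, if_pos (Nat.succ_le_of_lt m.2), sub_left_inj]
  obtain hm | hm := Nat.lt_or_ge (m.1 + 1) ρ.1
  · rw [scaledMat_zero_mul_apply (firstIdx_injective _) (mem_range_firstIdx_iff ρ), hw,
      if_neg hm.not_ge, add_zero]
    exact (jordanForm_mul_chainIdx_of_lt V ρ hm x q).trans
      (matTheta_mul_apply_of_lt (V.submatrix (chainIdx κ ρ) id) hm x q).symm
  · obtain rfl : m = lastPos ρ := Fin.ext (show m.1 = ρ.1 - 1 by omega)
    rw [matTheta_mul_apply_lastPos]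
    refine (scaledMat_zero_mul_lastIdx hB V (tailEquiv s ρ (Sum.inl x)) q).trans ?_
    rw [firstIdx_rows_eq_stackI_mul hB hW' h, ← Matrix.mul_assoc]
    exact congrFun₂ (congrArg (· * _) (matW_mul_stackI hW')) (Sum.inl x) q

theorem eq_zero_of_submatrix_chainIdx_eq_zero
    (hB : B.submatrix (lastIdx κ) (firstIdx κ) = matW D Xi Sg ρ.1)
    (hW' : IsUnit (matW D Xi Sg (ρ.1 + 1))) (hR : IsUnit R) {Ω : Matrix (Fin r) (Fin r) ℂ}
    (hΩ : IsUnit Ω) {V : Matrix (JordanIdx k s ⊕ κ) (Fin r) ℂ}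
    (hchain : V.submatrix (chainIdx κ ρ) id = 0)
    (h : ∀ a ∉ Set.range (chainIdx κ ρ), ∀ q,
      (scaledMat (jordanForm k s R) B (weight s κ ρ) ρ.1 0 * V) a q =
        (scaledId (weight s κ ρ) ρ.1 (0 : ℂ) * (V * Ω)) a q) : V = 0 := by
  have hfirst : V.submatrix (firstIdx κ : TailIdx k s ρ.1 → _) id = 0 := by
    rw [firstIdx_rows_eq_stackI_mul hB hW' h, hchain]
    exact Matrix.mul_zero _
  refine eq_zero_of_jordanForm_mul_eq hR hΩ hchain hfirst fun a ha q => ?_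
  rw [← scaledId_zero_mul_apply, ← h a ha,
    scaledMat_zero_mul_apply (firstIdx_injective _) (mem_range_firstIdx_iff ρ), hfirst,
    Matrix.mul_zero, Matrix.zero_apply, ite_self, add_zero]

theorem exists_isSimpleInvariantPair_limit
    (hB : B.submatrix (lastIdx κ) (firstIdx κ) = matW D Xi Sg ρ.1)
    (hW' : IsUnit (matW D Xi Sg (ρ.1 + 1))) (hR : IsUnit R) {Ω : Matrix (Fin r) (Fin r) ℂ}
    (hΩ : IsUnit Ω) {Φ : Matrix (Fin ρ.1 × Fin (s ρ.1)) (Fin r) ℂ}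
    {P : Matrix (Fin r) (Fin ρ.1 × Fin (s ρ.1)) ℂ}
    (h : IsSimpleInvariantPair (matTheta D Xi Sg ρ) 1 P Φ Ω) :
    ∃ (P' : Matrix (Fin r) (JordanIdx k s ⊕ κ) ℂ) (y : Matrix (JordanIdx k s ⊕ κ) (Fin r) ℂ),
      IsSimpleInvariantPair (scaledMat (jordanForm k s R) B (weight s κ ρ) ρ.1 0)
        (scaledId (weight s κ ρ) ρ.1 (0 : ℂ)) P' y Ω ∧
      y.submatrix (chainIdx κ ρ) id = Φ ∧
      y.submatrix (firstIdx κ) id = stackI ρ (matG D Xi Sg ρ) * topBlock ρ Φ := by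
  obtain ⟨P', y, hy, rfl⟩ := h.exists_of_submatrix (chainIdx_injective ρ)
    (fun V T => scaledMat_zero_mul_sub_submatrix_chainIdx hB hW')
    (fun V => eq_zero_of_submatrix_chainIdx_eq_zero hB hW' hR hΩ)
  exact ⟨P', y, hy, rfl, firstIdx_rows_eq_stackI_mul hB hW' fun a _ q => congrFun₂ hy.mul_eq a q⟩

end LimitPencil

section Similarity

variable {𝕜 ν ι β : Type*} [Field 𝕜] [Fintype ν] [Fintype ι] [DecidableEq ι]
  [Fintype β] [DecidableEq β] {X : Matrix ν ι 𝕜} {Y : Matrix ι ν 𝕜}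

theorem add_smul_mul_mul_of_mul_eq [DecidableEq ν] (hXY : X * Y = 1) {A D : Matrix ν ν 𝕜}
    {K : Matrix ι ι 𝕜} {lam c : 𝕜} (hA : A * X = X * (lam • 1 + K)) {V : Matrix ι β 𝕜}
    {C : Matrix β β 𝕜} (h : (K + c • (Y * D * X)) * V = V * C) :
    (A + c • D) * (X * V) = X * V * (lam • 1 + C) := by
  have hD : D * X = X * (Y * D * X) := by
    rw [← Matrix.mul_assoc, ← Matrix.mul_assoc, hXY, Matrix.one_mul]
  have hX : (A + c • D) * X = X * (lam • 1 + (K + c • (Y * D * X))) := by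
    rw [Matrix.add_mul, Matrix.smul_mul, hA, hD, ← add_assoc, Matrix.mul_add X (_ + _),
      Matrix.mul_smul]
  rw [← Matrix.mul_assoc, hX, Matrix.mul_assoc, Matrix.mul_assoc X V, Matrix.add_mul, h,
    Matrix.mul_add V, Matrix.smul_mul, Matrix.mul_smul, Matrix.one_mul, Matrix.mul_one]

theorem rank_mul_powDiag_mul (hYX : Y * X = 1) {z : 𝕜} (hz : z ≠ 0) (w : ι → ℕ)
    {P : Matrix β ι 𝕜} {y : Matrix ι β 𝕜} (hPy : P * y = 1) :
    (X * (powDiag w z * y)).rank = Fintype.card β := by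
  have powDiag_inv_mul : powDiag w z⁻¹ * powDiag w z = 1 := by
    simp only [powDiag, Matrix.diagonal_mul_diagonal, ← mul_pow, inv_mul_cancel₀ hz, one_pow,
      Matrix.diagonal_one]
  refine rank_eq_card_of_mul_eq_one (L := P * (powDiag w z⁻¹ * Y)) ?_
  rw [Matrix.mul_assoc, Matrix.mul_assoc, ← Matrix.mul_assoc Y, hYX, Matrix.one_mul,
    ← Matrix.mul_assoc (powDiag w z⁻¹), powDiag_inv_mul, Matrix.one_mul, hPy]

end Similarity

section Expansion

open Asymptotics
open scoped Matrix.Norms.Elementwise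

theorem matBigO_add_root_smul_sub {β : Type*} [Fintype β] {ρ : ℕ} (hρ : ρ ≠ 0)
    {C : ℂ → Matrix β β ℂ} {Ω : Matrix β β ℂ} (hC : (fun z => C z - Ω) =O[𝓝 0] fun z => z)
    (L : Matrix β β ℂ) :
    MatBigO (fun t => L + root ρ t • C (root ρ t) - (L + root ρ t • Ω)) (2 / ρ) := by
  simp only [add_sub_add_left_eq_sub, ← smul_sub]
  refine matBigO_comp_root (M := fun z => z • (C z - Ω)) (m := 2) hρ fun a q => ?_
  simp only [pow_two]
  exact (isBigO_refl _ _).mul (isBigO_entry hC a q)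

variable {n k : ℕ} {s : ℕ → ℕ} {κ β : Type*} {ρ : BlockSize k}

theorem fromBlocks_eq_smul_one_add_jordanForm [DecidableEq κ] (lam : ℂ) (A22 : Matrix κ κ ℂ) :
    Matrix.fromBlocks (lam • 1 + nilp k s) 0 0 A22 =
      lam • 1 + jordanForm k s (A22 - lam • 1) := by
  rw [jordanForm, ← Matrix.fromBlocks_one, Matrix.fromBlocks_smul, Matrix.fromBlocks_add,
    smul_zero, smul_zero, add_zero, add_zero, add_sub_cancel]

variable [Fintype κ]

theorem fromCols_mul_eq_sum_add (Xi : Matrix (Fin n) (JordanIdx k s) ℂ) (Xic : Matrix (Fin n) κ ℂ)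
    (V : Matrix (JordanIdx k s ⊕ κ) β ℂ) :
    Matrix.fromCols Xi Xic * V = ∑ i : BlockSize k, blockCol Xi i * V.submatrix (chainIdx κ i) id +
      Xic * V.submatrix Sum.inr id := by
  ext a q
  rw [Matrix.mul_apply, Fintype.sum_sum_type, Fintype.sum_sigma, Matrix.add_apply, Matrix.sum_apply]
  rfl

variable [DecidableEq κ]

theorem fromCols_mul_sub_leading (Xi : Matrix (Fin n) (JordanIdx k s) ℂ)
    (Xic : Matrix (Fin n) κ ℂ) (y : ℂ → Matrix (JordanIdx k s ⊕ κ) β ℂ)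
    (y₀ : Matrix (JordanIdx k s ⊕ κ) β ℂ) (z : ℂ) :
    Matrix.fromCols Xi Xic * (powDiag (weight s κ ρ) z * y z) -
        (firstCols Xi ρ.1 * y₀.submatrix (firstIdx κ : TailIdx k s ρ.1 → _) id + ∑ i : BlockSize k,
          blockCol Xi i * (deviation (weight s κ ρ) y y₀ z).submatrix (chainIdx κ i) id) =
      Xic * (deviation (weight s κ ρ) y y₀ z).submatrix Sum.inr id := by
  have leading : firstCols Xi ρ.1 * y₀.submatrix (firstIdx κ : TailIdx k s ρ.1 → _) id =
      Matrix.fromCols Xi Xic * (powDiag (weight s κ ρ) (0 : ℂ) * y₀) := by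
    rw [mul_powDiag_zero_mul (firstIdx_injective _) (mem_range_firstIdx_iff ρ)]
    rfl
  rw [leading, ← sub_sub, ← Matrix.mul_sub, ← deviation, fromCols_mul_eq_sum_add,
    add_sub_cancel_left]

variable {r : ℕ} {y : ℂ → Matrix (JordanIdx k s ⊕ κ) (Fin r) ℂ}
  {y₀ : Matrix (JordanIdx k s ⊕ κ) (Fin r) ℂ}

theorem matBigO_submatrix_inr (hy : (fun z => y z - y₀) =O[𝓝 0] fun z => z) :
    MatBigO (fun t => (deviation (weight s κ ρ) y y₀ (root ρ.1 t)).submatrix Sum.inr id) 1 := by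
  rw [← div_self (Nat.cast_ne_zero (R := ℝ).2 ρ.pos.ne')]
  refine matBigO_comp_root (m := ρ.1)
    (M := fun z => (deviation (weight s κ ρ) y y₀ z).submatrix Sum.inr id)
    ρ.pos.ne' fun a q => ?_
  have hw : max 1 (weight s κ ρ (Sum.inr a)) = ρ.1 := max_eq_right (Nat.succ_le_of_lt ρ.pos)
  have := isBigO_deviation hy (weight s κ ρ) (Sum.inr a) q
  rwa [hw] at this

theorem matBigO_blockRow_submatrix (hy : (fun z => y z - y₀) =O[𝓝 0] fun z => z) {i : BlockSize k}
    {m : Fin i.1} {e : ℕ} (he : ∀ x, max 1 (weight s κ ρ (chainIdx κ i (m, x))) = e) :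
    MatBigO (fun t => blockRow
      ((deviation (weight s κ ρ) y y₀ (root ρ.1 t)).submatrix (chainIdx κ i) id) m)
      (e / ρ.1) := by
  refine matBigO_comp_root
    (M := fun z => blockRow ((deviation (weight s κ ρ) y y₀ z).submatrix (chainIdx κ i) id) m)
    ρ.pos.ne' fun x q => ?_
  rw [← he x]
  exact isBigO_deviation hy (weight s κ ρ) (chainIdx κ i (m, x)) q

theorem matBigO_blockRow_submatrix_of_lt (hy : (fun z => y z - y₀) =O[𝓝 0] fun z => z)
    {i : BlockSize k} (hi : i.1 < ρ.1) (m : Fin i.1) :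
    MatBigO (fun t => blockRow
      ((deviation (weight s κ ρ) y y₀ (root ρ.1 t)).submatrix (chainIdx κ i) id) m)
      (1 - ((i.1 : ℝ) - m) / ρ.1) := by
  have exponent : 1 - ((i.1 : ℝ) - m) / ρ.1 = (ρ.1 - i.1 + m : ℕ) / ρ.1 := by
    have : (ρ.1 : ℝ) ≠ 0 := Nat.cast_ne_zero.2 ρ.pos.ne'
    rw [Nat.cast_add, Nat.cast_sub hi.le]
    field_simp
    ring
  rw [exponent]
  refine matBigO_blockRow_submatrix hy fun x => ?_
  rw [weight_chainIdx_of_le hi.le]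
  exact max_eq_right (Nat.le_add_right_of_le (Nat.sub_pos_of_lt hi))

theorem matBigO_blockRow_submatrix_sub (hy : (fun z => y z - y₀) =O[𝓝 0] fun z => z)
    {Ω : Matrix (Fin r) (Fin r) ℂ} {Φ : Matrix (Fin ρ.1 × Fin (s ρ.1)) (Fin r) ℂ}
    (hΦ : ∀ m x q, Φ (m, x) q = (topBlock ρ Φ * Ω ^ m.1) x q)
    (hchain : y₀.submatrix (chainIdx κ ρ) id = Φ) (m : Fin ρ.1) :
    MatBigO (fun t =>
      blockRow ((deviation (weight s κ ρ) y y₀ (root ρ.1 t)).submatrix (chainIdx κ ρ) id) m -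
        if m.1 = 0 then 0 else topBlock ρ Φ * (root ρ.1 t • Ω) ^ m.1) ((m + 1) / ρ.1) := by
  rw [← Nat.cast_add_one]
  refine matBigO_comp_root (M := fun z =>
      blockRow ((deviation (weight s κ ρ) y y₀ z).submatrix (chainIdx κ ρ) id) m -
        if m.1 = 0 then 0 else topBlock ρ Φ * (z • Ω) ^ m.1) ρ.pos.ne' fun x q => ?_
  have hw : weight s κ ρ (chainIdx κ ρ (m, x)) = m := by
    rw [weight_chainIdx_of_le le_rfl, Nat.sub_self, zero_add]
  have hy₀ : y₀ (chainIdx κ ρ (m, x)) q = (topBlock ρ Φ * Ω ^ m.1) x q := by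
    rw [← hΦ, ← hchain, Matrix.submatrix_apply, id_eq]
  have remainder := isBigO_powDiag_mul_sub_pow_mul hy (weight s κ ρ) (chainIdx κ ρ (m, x)) q
  rw [hw] at remainder
  refine remainder.congr_left fun z => ?_
  simp only [deviation, blockRow, Matrix.sub_apply, Matrix.of_apply, Matrix.submatrix_apply, id_eq,
    powDiag_mul_apply _ (0 : ℂ), hw, hy₀]
  split_ifs with hm
  · simp [hm]
  · simp [hm, smul_pow]

end Expansion

end JordanPert

theorem theorem3p2_general {n k r : ℕ} {s : ℕ → ℕ} {κ : Type*} [Fintype κ] [DecidableEq κ]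
    {A D : Matrix (Fin n) (Fin n) ℂ} {lam : ℂ} {Xi Sg : Matrix (Fin n) (JordanIdx k s) ℂ}
    {Xic Sgc : Matrix (Fin n) κ ℂ} {A22 : Matrix κ κ ℂ}
    (hinv : Matrix.fromCols Xi Xic * (Matrix.fromCols Sg Sgc).conjTranspose = 1)
    (hinv' : (Matrix.fromCols Sg Sgc).conjTranspose * Matrix.fromCols Xi Xic = 1)
    (hA : A * Matrix.fromCols Xi Xic =
      Matrix.fromCols Xi Xic * Matrix.fromBlocks (lam • 1 + nilp k s) 0 0 A22)
    (hlam : lam ∉ spectrum ℂ A22) {ρ : BlockSize k} (hW' : IsUnit (matW D Xi Sg (ρ.1 + 1)))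
    {Ω : Matrix (Fin r) (Fin r) ℂ} (hΩ : IsUnit Ω)
    {Φ : Matrix (Fin ρ.1 × Fin (s ρ.1)) (Fin r) ℂ} (hrank : Φ.rank = r)
    (hΦ : matTheta D Xi Sg ρ * Φ = Φ * Ω)
    (hsep : ∀ μ ∈ Ω.charpoly.roots,
      μ ∉ (matTheta D Xi Sg ρ).charpoly.roots - Ω.charpoly.roots) :
    ∃ (H : ℝ → Matrix (Fin n) (Fin r) ℂ) (C : ℝ → Matrix (Fin r) (Fin r) ℂ)
      (Hb : (i : BlockSize k) → ℝ → Matrix (Fin i.1 × Fin (s i.1)) (Fin r) ℂ),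
      (∀ᶠ t : ℝ in 𝓝[>] (0 : ℝ), (A + (t : ℂ) • D) * H t = H t * C t ∧ (H t).rank = r) ∧
      MatBigO (fun t => C t - (lam • 1 + ((t ^ (1 / (ρ.1 : ℝ)) : ℝ) : ℂ) • Ω)) (2 / (ρ.1 : ℝ)) ∧
      MatBigO (fun t => H t - (firstCols Xi ρ.1 * stackI ρ (matG D Xi Sg ρ) * topBlock ρ Φ +
        ∑ i : BlockSize k, blockCol Xi i * Hb i t)) 1 ∧
      (∀ m : Fin ρ.1, MatBigO
        (fun t => blockRow (Hb ρ t) m -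
          if (m : ℕ) = 0 then 0
          else topBlock ρ Φ * (((t ^ (1 / (ρ.1 : ℝ)) : ℝ) : ℂ) • Ω) ^ (m : ℕ))
        (((m : ℝ) + 1) / (ρ.1 : ℝ))) ∧
      (∀ i : BlockSize k, i.1 < ρ.1 → ∀ m : Fin i.1,
        MatBigO (fun t => blockRow (Hb i t) m) (1 - ((i.1 : ℝ) - (m : ℝ)) / (ρ.1 : ℝ))) ∧
      (∀ i : BlockSize k, ρ.1 < i.1 → ∀ m : Fin i.1,
        MatBigO (fun t => blockRow (Hb i t) m)
          ((max 1 (min (m : ℕ) ρ.1) : ℕ) / (ρ.1 : ℝ))) := by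
  have hR : IsUnit (A22 - lam • 1) := by
    rw [spectrum.notMem_iff, Algebra.algebraMap_eq_smul_one] at hlam
    simpa only [neg_sub] using hlam.neg
  obtain ⟨P, hP⟩ := exists_isSimpleInvariantPair (hrank.trans (Fintype.card_fin r).symm) hΦ hsep
  obtain ⟨P', y₀, hlimit, hchain, hfirst⟩ := exists_isSimpleInvariantPair_limit
    (B := (Matrix.fromCols Sg Sgc).conjTranspose * D * Matrix.fromCols Xi Xic) rfl hW' hR hΩ hP
  obtain ⟨y, C, hyC, hy, hC⟩ := hlimit.exists_scaled_curve (weight_eq_of_jordanForm_ne_zero ρ)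
  rw [fromBlocks_eq_smul_one_add_jordanForm] at hA
  refine ⟨fun t => Matrix.fromCols Xi Xic *
      (powDiag (weight s κ ρ) (root ρ.1 t) * y (root ρ.1 t)),
    fun t => lam • 1 + root ρ.1 t • C (root ρ.1 t),
    fun i t => (deviation (weight s κ ρ) y y₀ (root ρ.1 t)).submatrix (chainIdx κ i) id,
    ?_, matBigO_add_root_smul_sub ρ.pos.ne' hC _, ?_,
    matBigO_blockRow_submatrix_sub hy (eq_topBlock_mul_pow hΦ) hchain,
    fun i hi m => matBigO_blockRow_submatrix_of_lt hy hi m,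
    fun i hi m => matBigO_blockRow_submatrix hy fun x => by rw [weight_chainIdx_of_lt hi]⟩
  · filter_upwards [(tendsto_root ρ.pos.ne').eventually hyC, self_mem_nhdsWithin] with t hyCt ht
    rw [root_pow ρ.pos.ne' (le_of_lt ht)] at hyCt
    exact ⟨add_smul_mul_mul_of_mul_eq hinv hA hyCt.1,
      (rank_mul_powDiag_mul hinv' (root_ne_zero ht) _ hyCt.2).trans (Fintype.card_fin r)⟩
  · simp only [Matrix.mul_assoc, ← hfirst, fromCols_mul_sub_leading]
    exact (matBigO_submatrix_inr hy).const_mul Xic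

theorem theorem3p2 {n p k r : ℕ} (s : ℕ → ℕ) (_hsk : 0 < s k)
    (A D : Matrix (Fin n) (Fin n) ℂ) (lam : ℂ)
    (Xi Sg : Matrix (Fin n) (JordanIdx k s) ℂ) (Xic Sgc : Matrix (Fin n) (Fin p) ℂ)
    (A22 : Matrix (Fin p) (Fin p) ℂ)
    -- `[Ξ Ξ_c]` is invertible and the adjoint of `[Σ Σ_c]` is its inverse
    (hinv : Matrix.fromCols Xi Xic * (Matrix.fromCols Sg Sgc).conjTranspose = 1)
    (hinv' : (Matrix.fromCols Sg Sgc).conjTranspose * Matrix.fromCols Xi Xic = 1)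
    -- block diagonal form of `A`, with the modified Jordan form in the first block
    (hA : A * Matrix.fromCols Xi Xic =
      Matrix.fromCols Xi Xic * Matrix.fromBlocks (lam • 1 + nilp k s) 0 0 A22)
    (hlam : lam ∉ spectrum ℂ A22)
    (ρ : BlockSize k)
    -- generic condition; the second part is void for `ρ = k`
    (hW : IsUnit (matW D Xi Sg ρ.1)) (hW' : IsUnit (matW D Xi Sg (ρ.1 + 1)))
    -- `Φ` is a basis matrix of an invariant subspace of `Θ_ρ` on which `Θ_ρ` acts as `Ω`
    (Ω : Matrix (Fin r) (Fin r) ℂ) (Φ : Matrix (Fin ρ.1 × Fin (s ρ.1)) (Fin r) ℂ)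
    (hrank : Φ.rank = r) (hΦ : matTheta D Xi Sg ρ * Φ = Φ * Ω)
    -- the eigenvalues of `Ω` differ from the remaining ones of `Θ_ρ` (counted with multiplicity)
    (hsep : ∀ μ ∈ Ω.charpoly.roots,
      μ ∉ (matTheta D Xi Sg ρ).charpoly.roots - Ω.charpoly.roots) :
    ∃ (H : ℝ → Matrix (Fin n) (Fin r) ℂ) (C : ℝ → Matrix (Fin r) (Fin r) ℂ)
      (Hb : (i : BlockSize k) → ℝ → Matrix (Fin i.1 × Fin (s i.1)) (Fin r) ℂ),
      (∀ᶠ t : ℝ in 𝓝[>] (0 : ℝ), (A + (t : ℂ) • D) * H t = H t * C t ∧ (H t).rank = r) ∧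
      MatBigO (fun t => C t - (lam • 1 + ((t ^ (1 / (ρ.1 : ℝ)) : ℝ) : ℂ) • Ω)) (2 / (ρ.1 : ℝ)) ∧
      MatBigO (fun t => H t - (firstCols Xi ρ.1 * stackI ρ (matG D Xi Sg ρ) * topBlock ρ Φ +
        ∑ i : BlockSize k, blockCol Xi i * Hb i t)) 1 ∧
      -- block rows of `H_ρ`
      (∀ m : Fin ρ.1, MatBigO
        (fun t => blockRow (Hb ρ t) m -
          if (m : ℕ) = 0 then 0
          else topBlock ρ Φ * (((t ^ (1 / (ρ.1 : ℝ)) : ℝ) : ℂ) • Ω) ^ (m : ℕ))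
        (((m : ℝ) + 1) / (ρ.1 : ℝ))) ∧
      -- block rows of `H_i`, `i < ρ`: orders `t^{1-i/ρ}, t^{1-(i-1)/ρ}, …, t^{1-1/ρ}`
      (∀ i : BlockSize k, i.1 < ρ.1 → ∀ m : Fin i.1,
        MatBigO (fun t => blockRow (Hb i t) m) (1 - ((i.1 : ℝ) - (m : ℝ)) / (ρ.1 : ℝ))) ∧
      -- block rows of `H_i`, `i > ρ`: orders `t^{1/ρ}, t^{1/ρ}, t^{2/ρ}, …, t^{1-1/ρ}, t, …, t`
      (∀ i : BlockSize k, ρ.1 < i.1 → ∀ m : Fin i.1,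
        MatBigO (fun t => blockRow (Hb i t) m)
          ((max 1 (min (m : ℕ) ρ.1) : ℕ) / (ρ.1 : ℝ))) := by
  obtain ⟨P, hP⟩ := exists_isSimpleInvariantPair (hrank.trans (Fintype.card_fin r).symm) hΦ hsep
  exact theorem3p2_general hinv hinv' hA hlam hW'
    (isUnit_of_matTheta_mul (isUnit_matS hW hW') hΦ hP.normalized) hrank hΦ hsep
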